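/- Let $U_1, U_2, \dots$ be independent random variables uniform on $[-1,1]$, and let $G$ be a standard Gaussian random variable (mean $0$, variance $1$). For every $n \ge 1$, all real numbers $a_1,\dots,a_n$ with $\sum_{j=1}^n a_j^2 = 1$ and every $t > 0$, $$\mathbb{P}\left(\left|\sum_{j=1}^n a_jU_j\right| > t\right) \le C_*\,\mathbb{P}\left(\frac{1}{\sqrt3}|G| > t\right), \qquad C_* = \sup_{0<t<1}\frac{1-t}{\mathbb{P}(|G| > t\sqrt3)}.$$ The supremum is finite, $1.345118 \le C_* < 1.345119$, and it is attained at exactly one point $t_0 \in (0,1)$, which satisfies $0.642908 \le t_0 < 0.642909$. The constant $C_*$ is best possible: there is equality for $n = 1$, $a_1 = 1$, $t = t_0$, and hence the inequality fails for some $n$, $a$, $t$ if $C_*$ is replaced by any smaller constant. -/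

import Mathlib

open MeasureTheory ProbabilityTheory

/-- `gaussTail s = P(|G| > s)` for a standard Gaussian random variable `G`
(mean `0`, variance `1`). -/
noncomputable def gaussTail (s : ℝ) : ℝ :=
  (gaussianReal 0 1).real {x : ℝ | s < |x|}

/-- The ratio `(1 - t) / P(|G| > t √3)`. -/
noncomputable def tailRatio (t : ℝ) : ℝ :=
  (1 - t) / gaussTail (t * Real.sqrt 3)

/-- The constant `C_* = sup_{0 < t < 1} (1 - t) / P(|G| > t √3)`. -/
noncomputable def cStar : ℝ :=
  sSup (tailRatio '' Set.Ioo (0 : ℝ) 1)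

/-! Write `T(t)` for the two-sided tail of `G / √3`, namely `1 - gaussScale * gaussInt t`. By
symmetry it is enough to bound the one-sided tail of a sum with positive coefficients, normalised by
`ρ`, the Euclidean norm of the coefficients. The thresholds below and above `1.05` need different
arguments.

For `t ≤ 1.05` only the shape of the density matters. A sum of uniforms has an even log-concave
density with second moment `ρ² / 3`. Its two-sided tail is convex on the half-line, so bounds at a
few nodes propagate along chords. Gauss' inequality gives the nodes `2/3` and `0.7`. The nodes
`0.8`, `0.95`, `1.05` use log-concavity: at a given tail mass the second moment is smallest for a
truncated exponential (`exists_truncated_exponential`), which leaves a one-parameter inequality in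
`β` to be checked by certified polynomial bounds. Each chord is then compared with a tangent of the
convex function `T`. On `(0, 2/3]` the chord is exactly `1 - t`, the tail of a single uniform
variable. This is where `cStar` enters with no slack; all other comparisons use only `1.345118 ≤
cStar`.

For `t ≥ 1.05` the proof is by induction on the set of summands. If some coefficient satisfies `a i
^ 2 ≤ ρ ^ 2 / 4`, condition on its uniform variable, apply the induction hypothesis to the rest, and
use `upperTail_smoothing`: at such `t`, replacing a Gaussian component by a uniform one of equal
variance does not increase the tail. Otherwise there are at most three summands. The part of the box
beyond the threshold then lies in a corner simplex, whose volume gives an explicit bound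
(`le_pow_div`).

The constant is a calculus problem: the numerator of the derivative of `tailRatio` is strictly
decreasing on `[0, 1]` and changes sign between `0.642908` and `0.642909`. Optimality follows from
equality for one summand. -/

/-! ### Extremality of truncated exponentials among log-concave densities -/

/-- A decreasing function on the half-line that is log-concave at midpoints is log-concave:
it stays above every exponential that it dominates at the two ends of an interval. -/
theorem le_of_midpoint_logConcave {g : ℝ → ℝ} (anti : AntitoneOn g (Set.Ici 0))
    (mid : ∀ x y, 0 ≤ x → x ≤ y → g x * g y ≤ g ((x + y) / 2) ^ 2)
    {x z x₁ c κ : ℝ} (hc : 0 < c) (hx : 0 ≤ x) (hxz : x ≤ z) (hz : z ≤ x₁)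
    (h₁ : c * Real.exp (κ * x) ≤ g x) (h₂ : c * Real.exp (κ * x₁) ≤ g x₁) :
    c * Real.exp (κ * z) ≤ g z := by
  set r : ℝ → ℝ := fun w => g w * Real.exp (-(κ * w)) / c with hr
  have hle : ∀ w, 1 ≤ r w ↔ c * Real.exp (κ * w) ≤ g w := by
    intro w
    simp only [hr]
    rw [le_div_iff₀ hc, one_mul, Real.exp_neg, ← div_eq_mul_inv, le_div_iff₀ (Real.exp_pos _)]
  set S := r '' Set.Icc x x₁ with hS
  have hlow : ∀ w ∈ Set.Icc x x₁, Real.exp (κ * x₁ - |κ| * x₁) ≤ r w := by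
    intro w hw
    have h0 : 0 ≤ w := hx.trans hw.1
    have h3 : c * Real.exp (κ * x₁) ≤ g w :=
      h₂.trans (anti h0 (h0.trans hw.2) hw.2)
    have h4 : κ * w ≤ |κ| * x₁ :=
      (mul_le_mul_of_nonneg_right (le_abs_self κ) h0).trans
        (mul_le_mul_of_nonneg_left hw.2 (abs_nonneg κ))
    simp only [hr]
    rw [le_div_iff₀ hc, sub_eq_add_neg, Real.exp_add]
    calc Real.exp (κ * x₁) * Real.exp (-(|κ| * x₁)) * c
        = (c * Real.exp (κ * x₁)) * Real.exp (-(|κ| * x₁)) := by ring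
      _ ≤ g w * Real.exp (-(κ * w)) := by
          apply mul_le_mul h3 _ (Real.exp_pos _).le
          · exact (mul_pos hc (Real.exp_pos _)).le.trans h3
          · exact Real.exp_le_exp.2 (by linarith)
  have hne : S.Nonempty := ⟨r x, x, ⟨le_rfl, hxz.trans hz⟩, rfl⟩
  have hbdd : BddBelow S := ⟨Real.exp (κ * x₁ - |κ| * x₁), by
    rintro _ ⟨w, hw, rfl⟩; exact hlow w hw⟩
  have hm0 : 0 < sInf S := lt_of_lt_of_le (Real.exp_pos _)
    (le_csInf hne (by rintro _ ⟨w, hw, rfl⟩; exact hlow w hw))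
  have hinf : ∀ w ∈ Set.Icc x x₁, sInf S ≤ r w := fun w hw => csInf_le hbdd ⟨w, hw, rfl⟩
  rw [← hle]
  by_contra hcon
  push Not at hcon
  have hm1 : sInf S < 1 := (hinf z ⟨hxz, hz⟩).trans_lt hcon
  -- No continuity is assumed, so the infimum `m` of `r` need not be attained. Since `0 < m < 1`,
  -- there is still a point `w` with `r w ^ 2 < m`.
  have hsq : sInf S < Real.sqrt (sInf S) := by
    rw [Real.lt_sqrt hm0.le]; nlinarith
  obtain ⟨_, ⟨w, hw, rfl⟩, hwlt⟩ := exists_lt_of_csInf_lt hne hsq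
  have hrw0 : 0 < r w := hm0.trans_le (hinf w hw)
  have hrw : r w ^ 2 < sInf S := by
    have := Real.sq_sqrt hm0.le
    nlinarith
  have hmid : ∀ u v, 0 ≤ u → u ≤ v → (u + v) / 2 = w → r u * r v ≤ r w ^ 2 := by
    intro u v hu huv huw
    simp only [hr]
    have h5 := mid u v hu huv
    rw [huw] at h5
    have h6 : Real.exp (-(κ * u)) * Real.exp (-(κ * v)) = Real.exp (-(κ * w)) ^ 2 := by
      rw [← Real.exp_add, ← Real.exp_nat_mul]; congr 1; rw [← huw]; push_cast; ring
    calc g u * Real.exp (-(κ * u)) / c * (g v * Real.exp (-(κ * v)) / c)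
        = g u * g v * (Real.exp (-(κ * u)) * Real.exp (-(κ * v))) / c ^ 2 := by
          field_simp
      _ ≤ g w ^ 2 * Real.exp (-(κ * w)) ^ 2 / c ^ 2 := by rw [h6]; gcongr
      _ = _ := by ring
  -- Reflect the nearer endpoint in `w`. The value of `r` is at least `1` at that endpoint and at
  -- least `m` at its reflection, so the midpoint inequality forces `m ≤ r w ^ 2`.
  rcases le_total w ((x + x₁) / 2) with h | h
  · have h7 := hmid x (2 * w - x) hx (by linarith [hw.1]) (by ring)
    have h8 := hinf (2 * w - x) ⟨by linarith [hw.1], by linarith⟩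
    have h9 := (hle x).2 h₁
    nlinarith
  · have h7 := hmid (2 * w - x₁) x₁ (by linarith) (by linarith [hw.2]) (by ring)
    have h8 := hinf (2 * w - x₁) ⟨by linarith, by linarith [hw.2]⟩
    have h9 := (hle x₁).2 h₂
    nlinarith

/-- Among decreasing log-concave densities on the half-line with prescribed mass beyond `t`,
the second moment is at least that of a truncated exponential density. -/
theorem exists_truncated_exponential {g : ℝ → ℝ} (nonneg : ∀ x, 0 ≤ x → 0 ≤ g x)
    (anti : AntitoneOn g (Set.Ici 0))
    (mid : ∀ x y, 0 ≤ x → x ≤ y → g x * g y ≤ g ((x + y) / 2) ^ 2)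
    {t R : ℝ} (ht : 0 < t) (htR : t < R) (hp : 0 < ∫ x in t..R, g x) :
    ∃ y k b, 0 < y ∧ 0 ≤ k ∧ t < b ∧
      ∫ x in (0 : ℝ)..t, y * Real.exp (-(k * x)) = ∫ x in (0 : ℝ)..t, g x ∧
      ∫ x in t..b, y * Real.exp (-(k * x)) = ∫ x in t..R, g x ∧
      ∫ x in (0 : ℝ)..b, x ^ 2 * (y * Real.exp (-(k * x))) ≤ ∫ x in (0 : ℝ)..R, x ^ 2 * g x := by
  have gint : ∀ u v, 0 ≤ u → 0 ≤ v → IntervalIntegrable g volume u v := by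
    intro u v hu hv
    apply AntitoneOn.intervalIntegrable
    apply anti.mono
    intro x hx
    exact (le_min hu hv).trans hx.1
  have g2int : ∀ u v, 0 ≤ u → 0 ≤ v → IntervalIntegrable (fun x => x ^ 2 * g x) volume u v :=
    fun u v hu hv => (gint u v hu hv).continuousOn_mul (by fun_prop)
  have hgt : 0 < g t := by
    by_contra hcon
    push Not at hcon
    have : ∫ x in t..R, g x ≤ ∫ x in t..R, (0 : ℝ) := by
      apply intervalIntegral.integral_mono_on htR.le (gint _ _ ht.le (ht.trans htR).le)
        (by simp)
      intro x hx
      exact (anti ht.le (ht.le.trans hx.1) hx.1).trans hcon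
    simp at this
    linarith
  -- The comparison exponential agrees with `g` at `t` and has the same mass on `[0, t]`; its rate
  -- comes from the intermediate value theorem.
  obtain ⟨k, hk0, hk⟩ : ∃ k, 0 ≤ k ∧
      ∫ x in (0 : ℝ)..t, g t * Real.exp (k * (t - x)) = ∫ x in (0 : ℝ)..t, g x := by
    have hcont : Continuous fun k : ℝ => ∫ x in (0 : ℝ)..t, g t * Real.exp (k * (t - x)) := by
      apply intervalIntegral.continuous_parametric_intervalIntegral_of_continuous' (by fun_prop)
    set q := ∫ x in (0 : ℝ)..t, g x with hq
    have hq1 : t * g t ≤ q := by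
      have : ∫ x in (0 : ℝ)..t, g t ≤ q := by
        apply intervalIntegral.integral_mono_on ht.le (by simp) (gint _ _ le_rfl ht.le)
        intro x hx
        exact anti hx.1 ht.le hx.2
      simpa using this
    have hq0 : 0 < q := (mul_pos ht hgt).trans_le hq1
    -- At this rate the linear minorant `K * (t - x)` of the exponential already has mass `q` on
    -- `[0, t]` after multiplication by `g t`.
    set K := 2 * q / (t ^ 2 * g t) with hK
    have hK0 : 0 ≤ K := by positivity
    have hbig : q ≤ ∫ x in (0 : ℝ)..t, g t * Real.exp (K * (t - x)) := by
      have h1 : ∫ x in (0 : ℝ)..t, g t * (K * (t - x)) ≤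
          ∫ x in (0 : ℝ)..t, g t * Real.exp (K * (t - x)) := by
        apply intervalIntegral.integral_mono_on ht.le
          (Continuous.intervalIntegrable (by fun_prop) _ _)
          (Continuous.intervalIntegrable (by fun_prop) _ _)
        intro x _
        have := Real.add_one_le_exp (K * (t - x))
        gcongr
        linarith
      have h2 : ∫ x in (0 : ℝ)..t, g t * (K * (t - x)) = q := by
        rw [intervalIntegral.integral_const_mul, intervalIntegral.integral_const_mul,
          intervalIntegral.integral_sub (by simp) (by simp)]
        simp only [intervalIntegral.integral_const, sub_zero, smul_eq_mul, integral_id]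
        rw [hK]; field_simp; ring
      linarith
    have hsmall : ∫ x in (0 : ℝ)..t, g t * Real.exp (0 * (t - x)) ≤ q := by
      simpa using hq1
    obtain ⟨k, hk, hkq⟩ := intermediate_value_Icc hK0 hcont.continuousOn ⟨hsmall, hbig⟩
    exact ⟨k, hk.1, hkq⟩
  set h : ℝ → ℝ := fun x => g t * Real.exp (k * (t - x)) with hh
  have hhc : Continuous h := by fun_prop
  have hhpos : ∀ x, 0 < h x := fun x => mul_pos hgt (Real.exp_pos _)
  have hht : h t = g t := by simp [hh]
  have hright : ∀ x, t ≤ x → g x ≤ h x := by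
    intro x₁ hx₁
    by_contra hcon
    push Not at hcon
    have htx : t < x₁ := by
      rcases hx₁.eq_or_lt with h | h
      · rw [← h, hht] at hcon; exact absurd hcon (lt_irrefl _)
      · exact h
    -- Suppose `g` exceeds `h` at `x₁ > t` and also `h x ≤ g x` at some `x < t`. The exponential
    -- through `(x, h x)` and `(x₁, g x₁)` would then lie above `h` at `t`, where `g` and `h` agree.
    -- So `g < h` on all of `(0, t)`, against the equality of masses.
    have hlt : ∀ x ∈ Set.Ioo 0 t, 0 < h x - g x := by
      intro x hx
      by_contra hc2
      have hc3 : h x ≤ g x := by linarith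
      set ε := Real.log (g x₁ / h x₁) / (x₁ - x) with hε
      have hxx : 0 < x₁ - x := by linarith [hx.2]
      have hε0 : 0 < ε := div_pos (Real.log_pos ((one_lt_div (hhpos _)).2 hcon)) hxx
      have e1 : ∀ z, h x * Real.exp (-((ε - k) * x)) * Real.exp ((ε - k) * z)
          = h z * Real.exp (ε * (z - x)) := by
        intro z
        simp only [hh]
        rw [mul_assoc, mul_assoc, mul_assoc, ← Real.exp_add, ← Real.exp_add, ← Real.exp_add]
        ring_nf
      have e2 : h x₁ * Real.exp (ε * (x₁ - x)) = g x₁ := by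
        rw [hε, div_mul_cancel₀ _ hxx.ne', Real.exp_log (div_pos ((hhpos _).trans hcon) (hhpos _)),
          mul_div_cancel₀ _ (hhpos _).ne']
      have := le_of_midpoint_logConcave anti mid (c := h x * Real.exp (-((ε - k) * x)))
        (κ := ε - k) (x := x) (z := t) (x₁ := x₁) (mul_pos (hhpos _) (Real.exp_pos _))
        hx.1.le hx.2.le hx₁ (by rw [e1]; simpa using hc3) (by rw [e1, e2])
      rw [e1, hht] at this
      have h1 : 1 < Real.exp (ε * (t - x)) := by
        rw [Real.one_lt_exp_iff]; exact mul_pos hε0 (by linarith [hx.2])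
      nlinarith
    have := intervalIntegral.intervalIntegral_pos_of_pos_on
      ((hhc.intervalIntegrable _ _).sub (gint 0 t le_rfl ht.le)) hlt ht
    rw [intervalIntegral.integral_sub (hhc.intervalIntegrable _ _) (gint 0 t le_rfl ht.le), hk]
      at this
    linarith
  have hleft : ∫ x in (0 : ℝ)..t, x ^ 2 * h x ≤ ∫ x in (0 : ℝ)..t, x ^ 2 * g x := by
    -- By log-concavity `g - h` changes sign at most once on `[0, t]`, from negative to nonnegative,
    -- at `s = sInf S`. As the masses agree, weighting by `x² - s²` compares the second moments.
    set S := {x : ℝ | 0 ≤ x ∧ x ≤ t ∧ h x ≤ g x} with hS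
    have htS : t ∈ S := ⟨ht.le, le_rfl, hht.le⟩
    have hSb : BddBelow S := ⟨0, fun x hx => hx.1⟩
    set s := sInf S with hs
    have hs0 : 0 ≤ s := le_csInf ⟨t, htS⟩ fun x hx => hx.1
    have hpt : ∀ x ∈ Set.Icc 0 t, 0 ≤ (x ^ 2 - s ^ 2) * (g x - h x) := by
      intro x hx
      rcases lt_trichotomy x s with hxs | hxs | hxs
      · have : g x < h x := by
          by_contra hc
          exact absurd (csInf_le hSb ⟨hx.1, hx.2, not_lt.1 hc⟩) (not_le.2 hxs)
        apply mul_nonneg_of_nonpos_of_nonpos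
        · have := hx.1; nlinarith
        · linarith
      · rw [hxs]; simp
      · obtain ⟨x', hx', hlt⟩ := exists_lt_of_csInf_lt ⟨t, htS⟩ hxs
        have e1 : ∀ z, g t * Real.exp (k * t) * Real.exp (-k * z) = h z := by
          intro z
          simp only [hh]
          rw [mul_assoc, ← Real.exp_add]; ring_nf
        have := le_of_midpoint_logConcave anti mid (c := g t * Real.exp (k * t)) (κ := -k)
          (x := x') (z := x) (x₁ := t) (mul_pos hgt (Real.exp_pos _)) hx'.1 hlt.le hx.2
          (by rw [e1]; exact hx'.2.2) (by rw [e1, hht])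
        rw [e1] at this
        apply mul_nonneg
        · nlinarith
        · linarith
    have hint := intervalIntegral.integral_nonneg (μ := volume) ht.le hpt
    have hexp : ∫ x in (0 : ℝ)..t, (x ^ 2 - s ^ 2) * (g x - h x) =
        (∫ x in (0 : ℝ)..t, x ^ 2 * g x) - (∫ x in (0 : ℝ)..t, x ^ 2 * h x) -
        s ^ 2 * ((∫ x in (0 : ℝ)..t, g x) - ∫ x in (0 : ℝ)..t, h x) := by
      rw [← intervalIntegral.integral_sub (gint _ _ le_rfl ht.le) (hhc.intervalIntegrable _ _),
        ← intervalIntegral.integral_const_mul,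
        ← intervalIntegral.integral_sub (g2int _ _ le_rfl ht.le)
          (Continuous.intervalIntegrable (by fun_prop) _ _),
        ← intervalIntegral.integral_sub
          ((g2int _ _ le_rfl ht.le).sub (Continuous.intervalIntegrable (by fun_prop) _ _))
          (((gint _ _ le_rfl ht.le).sub (hhc.intervalIntegrable _ _)).const_mul _)]
      congr 1; ext x; ring
    rw [hexp, hk] at hint
    linarith
  have hR0 : 0 ≤ R := (ht.trans htR).le
  obtain ⟨b, hb, hbp⟩ : ∃ b ∈ Set.Icc t R, ∫ x in t..b, h x = ∫ x in t..R, g x := by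
    have hcont : Continuous fun b : ℝ => ∫ x in t..b, h x :=
      intervalIntegral.continuous_primitive (fun _ _ => hhc.intervalIntegrable _ _) t
    have hend : ∫ x in t..R, g x ≤ ∫ x in t..R, h x :=
      intervalIntegral.integral_mono_on htR.le (gint _ _ ht.le hR0) (hhc.intervalIntegrable _ _)
        fun x hx => hright x hx.1
    obtain ⟨b, hb, hbp⟩ := intermediate_value_Icc htR.le hcont.continuousOn
      ⟨by simpa using hp.le, hend⟩
    exact ⟨b, hb, hbp⟩
  have htb : t < b := by
    rcases hb.1.eq_or_lt with h | h
    · rw [← h, intervalIntegral.integral_same] at hbp; linarith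
    · exact h
  have hb0 : 0 ≤ b := (ht.trans htb).le
  -- To the right of `t` the function `h` dominates `g` and uses up the mass by `b`. Passing from
  -- `g` to the truncated `h` moves mass from beyond `b` to points below `b`; the weight `x² - b²`
  -- expresses this.
  have hfar : ∫ x in t..b, x ^ 2 * h x ≤ ∫ x in t..R, x ^ 2 * g x := by
    have h1 : 0 ≤ ∫ x in t..b, (b ^ 2 - x ^ 2) * (h x - g x) := by
      apply intervalIntegral.integral_nonneg htb.le
      intro x hx
      apply mul_nonneg
      · have := hx.1; have := hx.2; nlinarith
      · linarith [hright x hx.1]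
    have h2 : 0 ≤ ∫ x in b..R, (x ^ 2 - b ^ 2) * g x := by
      apply intervalIntegral.integral_nonneg hb.2
      intro x hx
      apply mul_nonneg
      · have := hx.1; nlinarith
      · exact nonneg x (hb0.trans hx.1)
    have e1 : ∫ x in t..b, (b ^ 2 - x ^ 2) * (h x - g x) =
        (∫ x in t..b, x ^ 2 * g x) - (∫ x in t..b, x ^ 2 * h x) -
        b ^ 2 * ((∫ x in t..b, g x) - ∫ x in t..b, h x) := by
      rw [← intervalIntegral.integral_sub (gint _ _ ht.le hb0) (hhc.intervalIntegrable _ _),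
        ← intervalIntegral.integral_const_mul,
        ← intervalIntegral.integral_sub (g2int _ _ ht.le hb0)
          (Continuous.intervalIntegrable (by fun_prop) _ _),
        ← intervalIntegral.integral_sub
          ((g2int _ _ ht.le hb0).sub (Continuous.intervalIntegrable (by fun_prop) _ _))
          (((gint _ _ ht.le hb0).sub (hhc.intervalIntegrable _ _)).const_mul _)]
      congr 1; ext x; ring
    have e2 : ∫ x in b..R, (x ^ 2 - b ^ 2) * g x =
        (∫ x in b..R, x ^ 2 * g x) - b ^ 2 * ∫ x in b..R, g x := by
      rw [← intervalIntegral.integral_const_mul,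
        ← intervalIntegral.integral_sub (g2int _ _ hb0 hR0) ((gint _ _ hb0 hR0).const_mul _)]
      congr 1; ext x; ring
    have e3 := intervalIntegral.integral_add_adjacent_intervals (gint t b ht.le hb0)
      (gint b R hb0 hR0)
    have e4 := intervalIntegral.integral_add_adjacent_intervals (g2int t b ht.le hb0)
      (g2int b R hb0 hR0)
    rw [e1] at h1
    rw [e2] at h2
    have e5 : (∫ x in t..b, h x) = (∫ x in t..b, g x) + ∫ x in b..R, g x := by rw [hbp, e3]
    rw [e5] at h1
    nlinarith
  refine ⟨g t * Real.exp (k * t), k, b, mul_pos hgt (Real.exp_pos _), hk0, htb, ?_, ?_, ?_⟩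
  all_goals
    have e : ∀ x, g t * Real.exp (k * t) * Real.exp (-(k * x)) = h x := by
      intro x
      simp only [hh]
      rw [mul_assoc, ← Real.exp_add]; ring_nf
    simp only [e]
  · exact hk
  · exact hbp
  · rw [← intervalIntegral.integral_add_adjacent_intervals (b := t)
        (Continuous.intervalIntegrable (by fun_prop) _ _)
        (Continuous.intervalIntegrable (by fun_prop) _ _),
      ← intervalIntegral.integral_add_adjacent_intervals (g2int 0 t le_rfl ht.le)
        (g2int t R ht.le hR0)]
    exact add_le_add hleft hfar

/-- The extremal relation between a tail probability and the second moment, expressed through the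
truncated exponential family. -/
theorem tail_secondMoment_relation {g : ℝ → ℝ} (nonneg : ∀ x, 0 ≤ x → 0 ≤ g x)
    (anti : AntitoneOn g (Set.Ici 0))
    (mid : ∀ x y, 0 ≤ x → x ≤ y → g x * g y ≤ g ((x + y) / 2) ^ 2)
    {t R q M : ℝ} (ht : 0 < t) (htR : t < R) (hq : ∫ x in (0 : ℝ)..t, g x = q)
    (hp : ∫ x in t..R, g x = 1 - q) (hq1 : q < 1) (hM : ∫ x in (0 : ℝ)..R, x ^ 2 * g x = M) :
    t ^ 2 ≤ 3 * M * q ^ 2 ∨ ∃ β, 0 < β ∧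
      t ^ 2 * (6 - 3 * (β ^ 2 + 2 * β) / (Real.exp β - 1)) ≤
        3 * M * Real.log (1 - q + q * Real.exp (-β)) ^ 2 := by
  obtain ⟨y, k, b, hy, hk, htb, h1, h2, h3⟩ :=
    exists_truncated_exponential nonneg anti mid ht htR (by rw [hp]; linarith)
  rw [hq] at h1
  rw [hp] at h2
  rw [hM] at h3
  have hb0 : 0 < b := ht.trans htb
  have h4 : ∫ x in (0 : ℝ)..b, y * Real.exp (-(k * x)) = 1 := by
    rw [← intervalIntegral.integral_add_adjacent_intervals (b := t)
        (Continuous.intervalIntegrable (by fun_prop) _ _)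
        (Continuous.intervalIntegrable (by fun_prop) _ _), h1, h2]
    ring
  -- For `k = 0` the extremal density is uniform on `[0, b]`, so `t = q * b` and `b² ≤ 3 * M`.
  rcases hk.eq_or_lt with hk0 | hk0
  · left
    subst hk0
    simp at h1 h4 h3
    have h5 : t = q * b := by rw [← h1]; linear_combination (-t) * h4
    have h6 : b ^ 2 ≤ 3 * M := by
      have : b ^ 3 / (2 + 1) * y = b ^ 2 * (b * y) / 3 := by ring
      rw [this, h4] at h3
      linarith
    rw [h5, mul_pow, mul_comm]
    exact mul_le_mul_of_nonneg_right h6 (sq_nonneg q)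
  · right
    have hprim : ∀ u, ∫ x in (0 : ℝ)..u, y * Real.exp (-(k * x)) =
        y / k * (1 - Real.exp (-(k * u))) := by
      intro u
      rw [intervalIntegral.integral_eq_sub_of_hasDerivAt
        (f := fun x => - (y / k) * Real.exp (-(k * x)))
        (fun x _ => by
          have := ((((hasDerivAt_id x).const_mul k).neg).exp).const_mul (-(y / k))
          exact this.congr_deriv (by simp; field_simp))
        (Continuous.intervalIntegrable (by fun_prop) _ _)]
      simp; ring
    have hprim2 : ∫ x in (0 : ℝ)..b, x ^ 2 * (y * Real.exp (-(k * x))) =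
        y / k ^ 3 * (2 - ((k * b) ^ 2 + 2 * (k * b) + 2) * Real.exp (-(k * b))) := by
      rw [intervalIntegral.integral_eq_sub_of_hasDerivAt
        (f := fun x => - (y / k ^ 3) * (((k * x) ^ 2 + 2 * (k * x) + 2) * Real.exp (-(k * x))))
        (fun x _ => by
          have h0 := (hasDerivAt_id x).const_mul k
          have := ((((h0.pow 2).add (h0.const_mul 2)).add_const 2).mul (h0.neg.exp)).const_mul
            (-(y / k ^ 3))
          exact this.congr_deriv (by simp; field_simp; ring))
        (Continuous.intervalIntegrable (by fun_prop) _ _)]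
      simp; ring
    rw [hprim] at h1 h4
    rw [hprim2] at h3
    have hβ : 0 < k * b := mul_pos hk0 hb0
    -- The parameter `β = k * b` is scale free. Unit mass fixes `y`, and mass `q` on `[0, t]` then
    -- gives `exp (-(k * t)) = 1 - q + q * exp (-β)`. Expressing `k * t` by the logarithm removes
    -- `k`.
    refine ⟨k * b, hβ, ?_⟩
    set β := k * b with hβd
    have hE : 1 < Real.exp β := by rwa [Real.one_lt_exp_iff]
    have hinv : Real.exp (-β) = (Real.exp β)⁻¹ := Real.exp_neg β
    have hlog : Real.log (1 - q + q * Real.exp (-β)) = -(k * t) := by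
      have : 1 - q + q * Real.exp (-β) = Real.exp (-(k * t)) := by
        rw [← h1]
        linear_combination (-(1 - Real.exp (-(k * t)))) * h4
      rw [this, Real.log_exp]
    rw [hlog]
    have hyk : y / k = Real.exp β / (Real.exp β - 1) := by
      rw [hinv] at h4
      have h0 : Real.exp β - 1 ≠ 0 := by linarith
      have : Real.exp β ≠ 0 := (Real.exp_pos _).ne'
      field_simp at h4 ⊢
      linarith
    have e1 : y / k ^ 3 * (2 - (β ^ 2 + 2 * β + 2) * Real.exp (-β)) =
        (6 - 3 * (β ^ 2 + 2 * β) / (Real.exp β - 1)) / (3 * k ^ 2) := by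
      have h0 : Real.exp β - 1 ≠ 0 := by linarith
      have h00 : Real.exp β ≠ 0 := (Real.exp_pos _).ne'
      rw [show y / k ^ 3 = y / k / k ^ 2 by field_simp, hyk, hinv]
      field_simp
      ring
    rw [e1, div_le_iff₀ (by positivity)] at h3
    have := mul_le_mul_of_nonneg_left h3 (sq_nonneg t)
    nlinarith

/-! ### Polynomial bounds for the exponential -/

/-- Taylor polynomials of `exp (-u)` alternately under- and overestimate it for `u ≥ 0`. -/
theorem exp_neg_partial_sum_alternating (n : ℕ) :
    ∀ u : ℝ, 0 ≤ u → 0 ≤ (-1 : ℝ) ^ n *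
      (Real.exp (-u) - ∑ k ∈ Finset.range n, (-u) ^ k / (k.factorial : ℝ)) := by
  induction n with
  | zero => intro u _; simp [Real.exp_nonneg]
  | succ n ih =>
    set F : ℝ → ℝ := fun u => (-1 : ℝ) ^ (n + 1) *
      (Real.exp (-u) - ∑ k ∈ Finset.range (n + 1), (-u) ^ k / (k.factorial : ℝ)) with hF
    have hd : ∀ u, HasDerivAt F ((-1 : ℝ) ^ n *
        (Real.exp (-u) - ∑ k ∈ Finset.range n, (-u) ^ k / (k.factorial : ℝ))) u := by
      intro u
      have hs : HasDerivAt (fun u : ℝ => ∑ k ∈ Finset.range (n + 1),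
          (-u) ^ k / (k.factorial : ℝ))
          (-∑ k ∈ Finset.range n, (-u) ^ k / (k.factorial : ℝ)) u := by
        have h1 : HasDerivAt (fun u : ℝ => ∑ k ∈ Finset.range (n + 1),
            (-u) ^ k / (k.factorial : ℝ))
            (∑ k ∈ Finset.range (n + 1), ((k : ℝ) * (-u) ^ (k - 1) * (-1)) / (k.factorial : ℝ)) u := by
          apply HasDerivAt.fun_sum
          intro k _
          exact ((hasDerivAt_neg u).pow k).div_const _
        convert h1 using 1
        rw [Finset.sum_range_succ', ← Finset.sum_neg_distrib]
        simp only [Nat.cast_zero, zero_mul, zero_div, add_zero]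
        apply Finset.sum_congr rfl
        intro k _
        rw [Nat.factorial_succ]
        push_cast
        have : (k.factorial : ℝ) ≠ 0 := by positivity
        have : (k : ℝ) + 1 ≠ 0 := by positivity
        field_simp
      have he : HasDerivAt (fun u : ℝ => Real.exp (-u)) (-Real.exp (-u)) u := by
        simpa using (hasDerivAt_neg u).exp
      exact ((he.sub hs).const_mul _).congr_deriv (by ring)
    have hmono : MonotoneOn F (Set.Ici 0) := by
      apply monotoneOn_of_deriv_nonneg (convex_Ici 0)
      · exact fun x _ => (hd x).continuousAt.continuousWithinAt
      · exact fun x _ => (hd x).differentiableAt.differentiableWithinAt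
      · intro x hx
        rw [interior_Ici] at hx
        rw [(hd x).deriv]
        exact ih x (le_of_lt hx)
    intro u hu
    have h0 : F 0 = 0 := by
      simp only [hF]
      rw [Finset.sum_range_succ']
      simp
    have := hmono (Set.self_mem_Ici) hu hu
    rw [h0] at this
    exact this

theorem sum_le_exp_of_even (m : ℕ) (x : ℝ) :
    ∑ k ∈ Finset.range (2 * m), x ^ k / (k.factorial : ℝ) ≤ Real.exp x := by
  rcases le_total 0 x with h | h
  · exact Real.sum_le_exp_of_nonneg h _
  · have := exp_neg_partial_sum_alternating (2 * m) (-x) (by linarith)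
    simp only [pow_mul, neg_neg, neg_one_sq, one_pow, one_mul] at this
    linarith

theorem exp_le_sum_of_odd (m : ℕ) {x : ℝ} (hx : x ≤ 0) :
    Real.exp x ≤ ∑ k ∈ Finset.range (2 * m + 1), x ^ k / (k.factorial : ℝ) := by
  have := exp_neg_partial_sum_alternating (2 * m + 1) (-x) (by linarith)
  rw [show (-1 : ℝ) ^ (2 * m + 1) = -1 by rw [pow_succ, pow_mul]; norm_num] at this
  simp only [neg_neg] at this
  linarith

theorem quintic_le_exp (x : ℝ) :
    1 + x + x ^ 2 / 2 + x ^ 3 / 6 + x ^ 4 / 24 + x ^ 5 / 120 ≤ Real.exp x := by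
  have := sum_le_exp_of_even 3 x
  norm_num [Finset.sum_range_succ, Nat.factorial] at this
  linarith

/-! ### The one-parameter inequality for truncated exponentials -/

/-- Weighted AM-GM: an affine lower bound for `log (b + (1 - b) e^{-β})`. -/
theorem neg_affine_le_log_mix {b w K₁ K₂ : ℝ} (β : ℝ) (hb : 0 < b) (hb1 : b < 1) (hw : 0 < w)
    (hw1 : w < 1) (h₁ : w ≤ b * Real.exp K₁) (h₂ : 1 - w ≤ (1 - b) * Real.exp K₂) :
    -((1 - w) * β + (w * K₁ + (1 - w) * K₂)) ≤ Real.log (b + (1 - b) * Real.exp (-β)) := by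
  have hc := strictConcaveOn_log_Ioi.concaveOn.2 (x := b / w)
    (y := (1 - b) / (1 - w) * Real.exp (-β)) (Set.mem_Ioi.2 (by positivity))
    (Set.mem_Ioi.2 (mul_pos (div_pos (by linarith) (by linarith)) (Real.exp_pos _)))
    hw.le (by linarith : 0 ≤ 1 - w) (by ring)
  have e : w • (b / w) + (1 - w) • ((1 - b) / (1 - w) * Real.exp (-β)) =
      b + (1 - b) * Real.exp (-β) := by
    have : 1 - w ≠ 0 := by linarith
    simp only [smul_eq_mul]
    field_simp
  rw [e] at hc
  -- `K₁` and `K₂` serve as rational upper bounds for `log (w / b)` and `log ((1 - w) / (1 - b))`.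
  have l1 : -K₁ ≤ Real.log (b / w) := by
    rw [Real.le_log_iff_exp_le (by positivity), Real.exp_neg, le_div_iff₀ hw,
      inv_mul_le_iff₀ (Real.exp_pos _)]
    linarith
  have l2 : -K₂ - β ≤ Real.log ((1 - b) / (1 - w) * Real.exp (-β)) := by
    rw [Real.log_mul (div_pos (by linarith) (by linarith)).ne' (Real.exp_pos _).ne', Real.log_exp]
    have : -K₂ ≤ Real.log ((1 - b) / (1 - w)) := by
      rw [Real.le_log_iff_exp_le (div_pos (by linarith) (by linarith)), Real.exp_neg,
        le_div_iff₀ (by linarith), inv_mul_le_iff₀ (Real.exp_pos _)]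
      linarith
    linarith
  simp only [smul_eq_mul] at hc
  nlinarith

/-- The number `(t * l) ^ 2` separates the two sides. The logarithm is nonpositive, so a lower bound
for it bounds its square; the second hypothesis is the other comparison with the denominator `exp β
- 1` cleared. -/
theorem sq_log_mix_le {t b β l : ℝ} (hb : 0 < b) (hb1 : b < 1) (hβ : 0 < β)
    (h₁ : -(t * l) ≤ Real.log (b + (1 - b) * Real.exp (-β)))
    (h₂ : 3 * β ^ 2 + 6 * β ≤ (6 - l ^ 2) * (Real.exp β - 1)) :
    Real.log (b + (1 - b) * Real.exp (-β)) ^ 2 ≤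
      t ^ 2 * (6 - 3 * (β ^ 2 + 2 * β) / (Real.exp β - 1)) := by
  have hE : 0 < Real.exp β - 1 := by
    have : 1 < Real.exp β := by rwa [Real.one_lt_exp_iff]
    linarith
  have he : Real.exp (-β) < 1 := by rw [Real.exp_lt_one_iff]; linarith
  have hlog : Real.log (b + (1 - b) * Real.exp (-β)) ≤ 0 := by
    apply Real.log_nonpos
    · have := Real.exp_pos (-β); nlinarith
    · nlinarith
  have h3 : l ^ 2 ≤ 6 - 3 * (β ^ 2 + 2 * β) / (Real.exp β - 1) := by
    rw [le_sub_comm, div_le_iff₀ hE]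
    linarith
  calc _ ≤ (t * l) ^ 2 := by nlinarith
    _ = t ^ 2 * l ^ 2 := by ring
    _ ≤ _ := by gcongr

/-- A cell of the covering: an affine function `l` of `β` lies between the two sides. -/
theorem sq_log_mix_le_of_cell {t b w K₁ K₂ β : ℝ} (ht : 0 < t) (hb : 0 < b) (hb1 : b < 1)
    (hβ : 0 < β) (hw : 0 < w) (hw1 : w < 1) 
    (h₁ : w ≤ b * ∑ k ∈ Finset.range (2 * 12), K₁ ^ k / (k.factorial : ℝ))
    (h₂ : 1 - w ≤ (1 - b) * ∑ k ∈ Finset.range (2 * 12), K₂ ^ k / (k.factorial : ℝ))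
    (m e₀ : ℝ) (he₀ : 0 ≤ e₀) (he : e₀ ≤ ∑ k ∈ Finset.range (2 * 12), m ^ k / (k.factorial : ℝ))
    (hl : 0 ≤ 6 - (((1 - w) * β + (w * K₁ + (1 - w) * K₂)) / t) ^ 2)
    (hpoly : 0 ≤ (6 - (((1 - w) * β + (w * K₁ + (1 - w) * K₂)) / t) ^ 2) *
      (e₀ * (1 + (β - m) + (β - m) ^ 2 / 2 + (β - m) ^ 3 / 6 + (β - m) ^ 4 / 24 +
        (β - m) ^ 5 / 120) - 1) - (3 * β ^ 2 + 6 * β)) :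
    Real.log (b + (1 - b) * Real.exp (-β)) ^ 2 ≤
      t ^ 2 * (6 - 3 * (β ^ 2 + 2 * β) / (Real.exp β - 1)) := by
  apply sq_log_mix_le (l := ((1 - w) * β + (w * K₁ + (1 - w) * K₂)) / t) hb hb1 hβ
  · rw [mul_div_cancel₀ _ ht.ne']
    refine neg_affine_le_log_mix β hb hb1 hw hw1 (h₁.trans ?_) (h₂.trans ?_)
    · exact mul_le_mul_of_nonneg_left (sum_le_exp_of_even 12 _) hb.le
    · exact mul_le_mul_of_nonneg_left (sum_le_exp_of_even 12 _) (by linarith)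
  · have h3 : e₀ * (1 + (β - m) + (β - m) ^ 2 / 2 + (β - m) ^ 3 / 6 + (β - m) ^ 4 / 24 +
        (β - m) ^ 5 / 120) ≤ Real.exp β := by
      have h4 : Real.exp β = Real.exp m * Real.exp (β - m) := by rw [← Real.exp_add]; ring_nf
      rw [h4]
      calc _ ≤ e₀ * Real.exp (β - m) := mul_le_mul_of_nonneg_left (quintic_le_exp _) he₀
        _ ≤ _ := mul_le_mul_of_nonneg_right (he.trans (sum_le_exp_of_even 12 _)) (Real.exp_pos _).le
    have := mul_le_mul_of_nonneg_left (sub_le_sub_right h3 1) hl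
    linarith

/-- Both sides vanish to second order at `β = 0`, so a tangent at `0` is needed: the weight `w = b`
makes both constants `K₁`, `K₂` zero and `l` linear. After inserting the quintic minorant of `exp`,
a factor `β³` splits off and `hpoly` is the remaining cofactor. -/
theorem sq_log_mix_le_near_zero {t b β : ℝ} (ht : 0 < t) (hb : 0 < b) (hb1 : b < 1)
    (hβ : 0 < β) (hl : 0 ≤ 6 - ((1 - b) / t * β) ^ 2)
    (hpoly : 0 ≤ (1 - ((1 - b) / t) ^ 2) + β * (1 / 4 - ((1 - b) / t) ^ 2 / 2) +
      β ^ 2 * (1 / 20 - ((1 - b) / t) ^ 2 / 6) - ((1 - b) / t) ^ 2 * β ^ 3 / 24 -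
      ((1 - b) / t) ^ 2 * β ^ 4 / 120) :
    Real.log (b + (1 - b) * Real.exp (-β)) ^ 2 ≤
      t ^ 2 * (6 - 3 * (β ^ 2 + 2 * β) / (Real.exp β - 1)) := by
  apply sq_log_mix_le (l := (1 - b) / t * β) hb hb1 hβ
  · rw [← mul_assoc, mul_div_cancel₀ _ ht.ne']
    have := neg_affine_le_log_mix (b := b) (w := b) (K₁ := 0) (K₂ := 0) β hb hb1 hb hb1
      (by simp) (by simp)
    simpa using this
  · have h4 := mul_le_mul_of_nonneg_left (sub_le_sub_right (quintic_le_exp β) 1) hl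
    have h5 := mul_nonneg (pow_nonneg hβ.le 3) hpoly
    nlinarith

/-- For large `β` the crude bound `log b ≥ -K` suffices. The remaining inequality between a multiple
of `exp β - 1` and a quadratic holds on `[m, ∞)` because it holds at `m` for the values and for the
first two derivatives, with `e₀` in place of `exp m`; these are `h0`, `h1`, `h2`. -/
theorem sq_log_mix_le_at_infinity {t b K β : ℝ} (ht : 0 < t) (hb : 0 < b) (hb1 : b < 1)
    (hβ : 0 < β) 
    (hK : 1 ≤ b * ∑ k ∈ Finset.range (2 * 12), K ^ k / (k.factorial : ℝ)) (m e₀ : ℝ) (hm0 : 0 ≤ m) (hm : m ≤ β) (he₀ : 0 ≤ e₀)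
    (he : e₀ ≤ ∑ k ∈ Finset.range (2 * 12), m ^ k / (k.factorial : ℝ))
    (h0 : 3 * m ^ 2 + 6 * m ≤ (6 - (K / t) ^ 2) * (e₀ - 1))
    (h1 : 6 * m + 6 ≤ (6 - (K / t) ^ 2) * e₀) (h2 : 6 ≤ (6 - (K / t) ^ 2) * e₀) :
    Real.log (b + (1 - b) * Real.exp (-β)) ^ 2 ≤
      t ^ 2 * (6 - 3 * (β ^ 2 + 2 * β) / (Real.exp β - 1)) := by
  apply sq_log_mix_le (l := K / t) hb hb1 hβ
  · rw [mul_div_cancel₀ _ ht.ne', Real.le_log_iff_exp_le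
      (add_pos hb (mul_pos (by linarith) (Real.exp_pos _))), Real.exp_neg]
    have : (Real.exp K)⁻¹ ≤ b := by
      rw [inv_le_iff_one_le_mul₀ (Real.exp_pos _)]
      exact hK.trans (mul_le_mul_of_nonneg_left (sum_le_exp_of_even 12 _) hb.le)
    have := mul_pos (by linarith : 0 < 1 - b) (Real.exp_pos (-β))
    linarith
  · have h6 : 0 < 6 - (K / t) ^ 2 := by
      by_contra hc
      push Not at hc
      nlinarith
    have h3 : e₀ * (1 + (β - m) + (β - m) ^ 2 / 2) ≤ Real.exp β := by
      have h4 : Real.exp β = Real.exp m * Real.exp (β - m) := by rw [← Real.exp_add]; ring_nf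
      rw [h4]
      calc _ ≤ e₀ * Real.exp (β - m) :=
            mul_le_mul_of_nonneg_left (Real.quadratic_le_exp_of_nonneg (by linarith)) he₀
        _ ≤ _ := mul_le_mul_of_nonneg_right (he.trans (sum_le_exp_of_even 12 _)) (Real.exp_pos _).le
    have h7 := mul_le_mul_of_nonneg_left (sub_le_sub_right h3 1) h6.le
    have h8 := mul_nonneg (sub_nonneg.2 h1) (sub_nonneg.2 hm)
    have h9 := mul_nonneg (sub_nonneg.2 h2) (sq_nonneg (β - m))
    nlinarith

/-- These are the Bernstein products `s ^ i * (1 - s) ^ (7 - i)` in expanded form. The polynomial of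
a cell has degree seven, two from the square of the affine function and five from the Taylor
minorant; `linarith` writes it as a nonnegative combination of them. -/
theorem bernstein_seven_nonneg {s : ℝ} (h0 : 0 ≤ s) (h1 : 0 ≤ 1 - s) :
    0 ≤ 1 - s * 7 + s ^ 2 * 21 - s ^ 3 * 35 + s ^ 4 * 35 - s ^ 5 * 21 + s ^ 6 * 7 - s ^ 7 ∧
    0 ≤ s - s ^ 2 * 6 + s ^ 3 * 15 - s ^ 4 * 20 + s ^ 5 * 15 - s ^ 6 * 6 + s ^ 7 ∧
    0 ≤ s ^ 2 - s ^ 3 * 5 + s ^ 4 * 10 - s ^ 5 * 10 + s ^ 6 * 5 - s ^ 7 ∧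
    0 ≤ s ^ 3 - s ^ 4 * 4 + s ^ 5 * 6 - s ^ 6 * 4 + s ^ 7 ∧
    0 ≤ s ^ 4 - s ^ 5 * 3 + s ^ 6 * 3 - s ^ 7 ∧
    0 ≤ s ^ 5 - s ^ 6 * 2 + s ^ 7 ∧ 0 ≤ s ^ 6 - s ^ 7 ∧ 0 ≤ s ^ 7 := by
  have key : ∀ i j : ℕ, 0 ≤ s ^ i * (1 - s) ^ j :=
    fun i j => mul_nonneg (pow_nonneg h0 i) (pow_nonneg h1 j)
  refine ⟨?_, ?_, ?_, ?_, ?_, ?_, ?_, ?_⟩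
  · linarith [key 0 7]
  · linarith [key 1 6]
  · linarith [key 2 5]
  · linarith [key 3 4]
  · linarith [key 4 3]
  · linarith [key 5 2]
  · linarith [key 6 1]
  · linarith [key 7 0]

/-- Certifies that the tail at `0.8` is at most `0.217`. The half-line of `β` is cut into a piece at
`0`, several cells and a piece at infinity. In each cell `w` makes the affine bound tangent to the
logarithm at an interior point, `K₁` and `K₂` are `log (w / b)` and `log ((1 - w) / (1 - b))`
rounded up, and `e₀` is `exp m` rounded down. The two later nodes follow the same scheme. -/
theorem sq_log_mix_le_four_fifths {β : ℝ} (hβ : 0 < β) :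
    Real.log (0.217 + (1 - 0.217) * Real.exp (-β)) ^ 2 ≤
      0.8 ^ 2 * (6 - 3 * (β ^ 2 + 2 * β) / (Real.exp β - 1)) := by
  rcases le_total β 0.155 with h₁ | h₁
  · apply sq_log_mix_le_near_zero (by norm_num) (by norm_num) (by norm_num) hβ
    · norm_num; nlinarith
    · ring_nf; nlinarith [pow_le_pow_left₀ hβ.le h₁ 2, pow_le_pow_left₀ hβ.le h₁ 3,
        pow_le_pow_left₀ hβ.le h₁ 4]
  rcases le_total β 0.44 with h₂ | h₂
  · obtain ⟨s, rfl⟩ : ∃ s, β = 0.155 + 0.285 * s := ⟨(β - 0.155) / 0.285, by ring⟩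
    obtain ⟨b₀, b₁, b₂, b₃, b₄, b₅, b₆, b₇⟩ :=
      bernstein_seven_nonneg (s := s) (by linarith) (by linarith)
    apply sq_log_mix_le_of_cell (w := 0.26) (K₁ := 0.180785) (K₂ := -0.056482) (m := 0.3) (e₀ := 1.34985)
      (by norm_num) (by norm_num) (by norm_num) hβ (by norm_num)
      (by norm_num)
      (by norm_num [Finset.sum_range_succ, Nat.factorial])
      (by norm_num [Finset.sum_range_succ, Nat.factorial]) (by norm_num)
      (by norm_num [Finset.sum_range_succ, Nat.factorial])
    · ring_nf
      nlinarith
    · ring_nf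
      linarith
  clear h₁
  rename' h₂ => h₁
  rcases le_total β 0.91 with h₂ | h₂
  · obtain ⟨s, rfl⟩ : ∃ s, β = 0.44 + 0.47 * s := ⟨(β - 0.44) / 0.47, by ring⟩
    obtain ⟨b₀, b₁, b₂, b₃, b₄, b₅, b₆, b₇⟩ :=
      bernstein_seven_nonneg (s := s) (by linarith) (by linarith)
    apply sq_log_mix_le_of_cell (w := 0.34) (K₁ := 0.449049) (K₂ := -0.170892) (m := 0.68) (e₀ := 1.97387)
      (by norm_num) (by norm_num) (by norm_num) hβ (by norm_num)
      (by norm_num)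
      (by norm_num [Finset.sum_range_succ, Nat.factorial])
      (by norm_num [Finset.sum_range_succ, Nat.factorial]) (by norm_num)
      (by norm_num [Finset.sum_range_succ, Nat.factorial])
    · ring_nf
      nlinarith
    · ring_nf
      linarith
  clear h₁
  rename' h₂ => h₁
  rcases le_total β 1.79 with h₂ | h₂
  · obtain ⟨s, rfl⟩ : ∃ s, β = 0.91 + 0.88 * s := ⟨(β - 0.91) / 0.88, by ring⟩
    obtain ⟨b₀, b₁, b₂, b₃, b₄, b₅, b₆, b₇⟩ :=
      bernstein_seven_nonneg (s := s) (by linarith) (by linarith)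
    apply sq_log_mix_le_of_cell (w := 0.47) (K₁ := 0.772836) (K₂ := -0.390255) (m := 1.35) (e₀ := 3.85742)
      (by norm_num) (by norm_num) (by norm_num) hβ (by norm_num)
      (by norm_num)
      (by norm_num [Finset.sum_range_succ, Nat.factorial])
      (by norm_num [Finset.sum_range_succ, Nat.factorial]) (by norm_num)
      (by norm_num [Finset.sum_range_succ, Nat.factorial])
    · ring_nf
      nlinarith
    · ring_nf
      linarith
  clear h₁
  rename' h₂ => h₁
  rcases le_total β 3.2 with h₂ | h₂
  · obtain ⟨s, rfl⟩ : ∃ s, β = 1.79 + 1.41 * s := ⟨(β - 1.79) / 1.41, by ring⟩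
    obtain ⟨b₀, b₁, b₂, b₃, b₄, b₅, b₆, b₇⟩ :=
      bernstein_seven_nonneg (s := s) (by linarith) (by linarith)
    apply sq_log_mix_le_of_cell (w := 0.76) (K₁ := 1.253422) (K₂ := -1.182493) (m := 2.5) (e₀ := 12.18249)
      (by norm_num) (by norm_num) (by norm_num) hβ (by norm_num)
      (by norm_num)
      (by norm_num [Finset.sum_range_succ, Nat.factorial])
      (by norm_num [Finset.sum_range_succ, Nat.factorial]) (by norm_num)
      (by norm_num [Finset.sum_range_succ, Nat.factorial])
    · ring_nf
      nlinarith
    · ring_nf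
      linarith
  clear h₁
  rename' h₂ => h₁
  exact sq_log_mix_le_at_infinity (K := 1.5279) (by norm_num) (by norm_num) (by norm_num) hβ
      (by norm_num [Finset.sum_range_succ, Nat.factorial]) 3.2 24.53 (by norm_num) h₁ (by norm_num)
      (by norm_num [Finset.sum_range_succ, Nat.factorial]) (by norm_num)
    (by norm_num) (by norm_num)

theorem sq_log_mix_le_nineteen_twentieths {β : ℝ} (hβ : 0 < β) :
    Real.log (0.1295 + (1 - 0.1295) * Real.exp (-β)) ^ 2 ≤
      0.95 ^ 2 * (6 - 3 * (β ^ 2 + 2 * β) / (Real.exp β - 1)) := by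
  rcases le_total β 0.64 with h₁ | h₁
  · apply sq_log_mix_le_near_zero (by norm_num) (by norm_num) (by norm_num) hβ
    · norm_num; nlinarith
    · ring_nf; nlinarith [pow_le_pow_left₀ hβ.le h₁ 2, pow_le_pow_left₀ hβ.le h₁ 3,
        pow_le_pow_left₀ hβ.le h₁ 4]
  rcases le_total β 1.54 with h₂ | h₂
  · obtain ⟨s, rfl⟩ : ∃ s, β = 0.64 + 0.9 * s := ⟨(β - 0.64) / 0.9, by ring⟩
    obtain ⟨b₀, b₁, b₂, b₃, b₄, b₅, b₆, b₇⟩ :=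
      bernstein_seven_nonneg (s := s) (by linarith) (by linarith)
    apply sq_log_mix_le_of_cell (w := 0.31) (K₁ := 0.872892) (K₂ := -0.232376) (m := 1.09) (e₀ := 2.97427)
      (by norm_num) (by norm_num) (by norm_num) hβ (by norm_num)
      (by norm_num)
      (by norm_num [Finset.sum_range_succ, Nat.factorial])
      (by norm_num [Finset.sum_range_succ, Nat.factorial]) (by norm_num)
      (by norm_num [Finset.sum_range_succ, Nat.factorial])
    · ring_nf
      nlinarith
    · ring_nf
      linarith
  clear h₁
  rename' h₂ => h₁
  rcases le_total β 2.42 with h₂ | h₂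
  · obtain ⟨s, rfl⟩ : ∃ s, β = 1.54 + 0.88 * s := ⟨(β - 1.54) / 0.88, by ring⟩
    obtain ⟨b₀, b₁, b₂, b₃, b₄, b₅, b₆, b₇⟩ :=
      bernstein_seven_nonneg (s := s) (by linarith) (by linarith)
    apply sq_log_mix_le_of_cell (w := 0.51) (K₁ := 1.37073) (K₂ := -0.574662) (m := 1.98) (e₀ := 7.24274)
      (by norm_num) (by norm_num) (by norm_num) hβ (by norm_num)
      (by norm_num)
      (by norm_num [Finset.sum_range_succ, Nat.factorial])
      (by norm_num [Finset.sum_range_succ, Nat.factorial]) (by norm_num)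
      (by norm_num [Finset.sum_range_succ, Nat.factorial])
    · ring_nf
      nlinarith
    · ring_nf
      linarith
  clear h₁
  rename' h₂ => h₁
  rcases le_total β 4.2 with h₂ | h₂
  · obtain ⟨s, rfl⟩ : ∃ s, β = 2.42 + 1.78 * s := ⟨(β - 2.42) / 1.78, by ring⟩
    obtain ⟨b₀, b₁, b₂, b₃, b₄, b₅, b₆, b₇⟩ :=
      bernstein_seven_nonneg (s := s) (by linarith) (by linarith)
    apply sq_log_mix_le_of_cell (w := 0.74) (K₁ := 1.74297) (K₂ := -1.208386) (m := 3.31) (e₀ := 27.38512)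
      (by norm_num) (by norm_num) (by norm_num) hβ (by norm_num)
      (by norm_num)
      (by norm_num [Finset.sum_range_succ, Nat.factorial])
      (by norm_num [Finset.sum_range_succ, Nat.factorial]) (by norm_num)
      (by norm_num [Finset.sum_range_succ, Nat.factorial])
    · ring_nf
      nlinarith
    · ring_nf
      linarith
  clear h₁
  rename' h₂ => h₁
  exact sq_log_mix_le_at_infinity (K := 2.0441) (by norm_num) (by norm_num) (by norm_num) hβ
      (by norm_num [Finset.sum_range_succ, Nat.factorial]) 4.2 66.68 (by norm_num) h₁ (by norm_num)
      (by norm_num [Finset.sum_range_succ, Nat.factorial]) (by norm_num)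
    (by norm_num) (by norm_num)

theorem sq_log_mix_le_twentyone_twentieths {β : ℝ} (hβ : 0 < β) :
    Real.log (0.0922 + (1 - 0.0922) * Real.exp (-β)) ^ 2 ≤
      1.05 ^ 2 * (6 - 3 * (β ^ 2 + 2 * β) / (Real.exp β - 1)) := by
  rcases le_total β 1.03 with h₁ | h₁
  · apply sq_log_mix_le_near_zero (by norm_num) (by norm_num) (by norm_num) hβ
    · norm_num; nlinarith
    · ring_nf; nlinarith [pow_le_pow_left₀ hβ.le h₁ 2, pow_le_pow_left₀ hβ.le h₁ 3,
        pow_le_pow_left₀ hβ.le h₁ 4]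
  rcases le_total β 2.2 with h₂ | h₂
  · obtain ⟨s, rfl⟩ : ∃ s, β = 1.03 + 1.17 * s := ⟨(β - 1.03) / 1.17, by ring⟩
    obtain ⟨b₀, b₁, b₂, b₃, b₄, b₅, b₆, b₇⟩ :=
      bernstein_seven_nonneg (s := s) (by linarith) (by linarith)
    apply sq_log_mix_le_of_cell (w := 0.37) (K₁ := 1.389543) (K₂ := -0.365304) (m := 1.62) (e₀ := 5.05309)
      (by norm_num) (by norm_num) (by norm_num) hβ (by norm_num)
      (by norm_num)
      (by norm_num [Finset.sum_range_succ, Nat.factorial])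
      (by norm_num [Finset.sum_range_succ, Nat.factorial]) (by norm_num)
      (by norm_num [Finset.sum_range_succ, Nat.factorial])
    · ring_nf
      nlinarith
    · ring_nf
      linarith
  clear h₁
  rename' h₂ => h₁
  rcases le_total β 2.94 with h₂ | h₂
  · obtain ⟨s, rfl⟩ : ∃ s, β = 2.2 + 0.74 * s := ⟨(β - 2.2) / 0.74, by ring⟩
    obtain ⟨b₀, b₁, b₂, b₃, b₄, b₅, b₆, b₇⟩ :=
      bernstein_seven_nonneg (s := s) (by linarith) (by linarith)
    apply sq_log_mix_le_of_cell (w := 0.58) (K₁ := 1.839068) (K₂ := -0.770769) (m := 2.57) (e₀ := 13.06582)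
      (by norm_num) (by norm_num) (by norm_num) hβ (by norm_num)
      (by norm_num)
      (by norm_num [Finset.sum_range_succ, Nat.factorial])
      (by norm_num [Finset.sum_range_succ, Nat.factorial]) (by norm_num)
      (by norm_num [Finset.sum_range_succ, Nat.factorial])
    · ring_nf
      nlinarith
    · ring_nf
      linarith
  clear h₁
  rename' h₂ => h₁
  rcases le_total β 3.96 with h₂ | h₂
  · obtain ⟨s, rfl⟩ : ∃ s, β = 2.94 + 1.02 * s := ⟨(β - 2.94) / 1.02, by ring⟩
    obtain ⟨b₀, b₁, b₂, b₃, b₄, b₅, b₆, b₇⟩ :=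
      bernstein_seven_nonneg (s := s) (by linarith) (by linarith)
    apply sq_log_mix_le_of_cell (w := 0.73) (K₁ := 2.069085) (K₂ := -1.212602) (m := 3.45) (e₀ := 31.50039)
      (by norm_num) (by norm_num) (by norm_num) hβ (by norm_num)
      (by norm_num)
      (by norm_num [Finset.sum_range_succ, Nat.factorial])
      (by norm_num [Finset.sum_range_succ, Nat.factorial]) (by norm_num)
      (by norm_num [Finset.sum_range_succ, Nat.factorial])
    · ring_nf
      nlinarith
    · ring_nf
      linarith
  clear h₁
  rename' h₂ => h₁
  rcases le_total β 5 with h₂ | h₂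
  · obtain ⟨s, rfl⟩ : ∃ s, β = 3.96 + 1.04 * s := ⟨(β - 3.96) / 1.04, by ring⟩
    obtain ⟨b₀, b₁, b₂, b₃, b₄, b₅, b₆, b₇⟩ :=
      bernstein_seven_nonneg (s := s) (by linarith) (by linarith)
    apply sq_log_mix_le_of_cell (w := 0.93) (K₁ := 2.311225) (K₂ := -2.562528) (m := 4.48) (e₀ := 88.23467)
      (by norm_num) (by norm_num) (by norm_num) hβ (by norm_num)
      (by norm_num)
      (by norm_num [Finset.sum_range_succ, Nat.factorial])
      (by norm_num [Finset.sum_range_succ, Nat.factorial]) (by norm_num)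
      (by norm_num [Finset.sum_range_succ, Nat.factorial])
    · ring_nf
      nlinarith
    · ring_nf
      linarith
  clear h₁
  rename' h₂ => h₁
  exact sq_log_mix_le_at_infinity (K := 2.3838) (by norm_num) (by norm_num) (by norm_num) hβ
      (by norm_num [Finset.sum_range_succ, Nat.factorial]) 5 148.41 (by norm_num) h₁ (by norm_num)
      (by norm_num [Finset.sum_range_succ, Nat.factorial]) (by norm_num)
    (by norm_num) (by norm_num)

/-! ### The Gaussian tail and the constant `cStar` -/

/-- The primitive `∫₀ᵗ e^{-3v²/2} dv`. -/
noncomputable def gaussInt (t : ℝ) : ℝ := ∫ v in (0 : ℝ)..t, Real.exp (-(3 / 2 * v ^ 2))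

/-- The constant `√(6/π)`, for which `P(|G| > t√3) = 1 - √(6/π) ∫₀ᵗ e^{-3v²/2} dv`. -/
noncomputable def gaussScale : ℝ := Real.sqrt (6 / Real.pi)

/-- The tail `P(G/√3 > z)` of a centred Gaussian variable of variance `1/3`. -/
noncomputable def upperTail (z : ℝ) : ℝ := (1 - gaussScale * gaussInt z) / 2

theorem gaussScale_pos : 0 < gaussScale := Real.sqrt_pos.2 (by positivity)

theorem gaussScale_gt : 1.38197659788 < gaussScale := by
  rw [gaussScale, Real.lt_sqrt (by norm_num), lt_div_iff₀ Real.pi_pos]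
  have := Real.pi_lt_d20
  nlinarith

theorem gaussScale_lt : gaussScale < 1.38197659789 := by
  rw [gaussScale, Real.sqrt_lt' (by norm_num), div_lt_iff₀ Real.pi_pos]
  have := Real.pi_gt_d20
  nlinarith

theorem continuous_gaussDensity : Continuous fun v : ℝ => Real.exp (-(3 / 2 * v ^ 2)) := by fun_prop

theorem hasDerivAt_gaussInt (t : ℝ) :
    HasDerivAt gaussInt (Real.exp (-(3 / 2 * t ^ 2))) t :=
  intervalIntegral.integral_hasDerivAt_right (continuous_gaussDensity.intervalIntegrable _ _)
    (continuous_gaussDensity.stronglyMeasurableAtFilter _ _) continuous_gaussDensity.continuousAt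

theorem continuous_gaussInt : Continuous gaussInt :=
  continuous_iff_continuousAt.2 fun t => (hasDerivAt_gaussInt t).continuousAt

theorem gaussInt_neg (t : ℝ) : gaussInt (-t) = -gaussInt t := by
  have := intervalIntegral.integral_comp_neg (a := 0) (b := t)
    (fun v : ℝ => Real.exp (-(3 / 2 * v ^ 2)))
  simp only [neg_sq, neg_zero] at this
  rw [gaussInt, intervalIntegral.integral_symm, ← this, gaussInt]

theorem gaussInt_mono : Monotone gaussInt :=
  monotone_of_deriv_nonneg (fun t => (hasDerivAt_gaussInt t).differentiableAt)
    fun t => by rw [(hasDerivAt_gaussInt t).deriv]; positivity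

theorem gaussTail_mul_sqrt_three {t : ℝ} (ht : 0 ≤ t) :
    gaussTail (t * Real.sqrt 3) = 1 - gaussScale * gaussInt t := by
  have h3 : 0 < Real.sqrt 3 := Real.sqrt_pos.2 (by norm_num)
  have hs : 0 ≤ t * Real.sqrt 3 := by positivity
  have hset : {x : ℝ | t * Real.sqrt 3 < |x|} =
      (Set.Icc (-(t * Real.sqrt 3)) (t * Real.sqrt 3))ᶜ := by
    ext x
    simp only [Set.mem_ofPred_eq, Set.mem_compl_iff, Set.mem_Icc, ← abs_le, not_le]
  have hpdf : ∀ x, gaussianPDFReal 0 1 x =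
      (Real.sqrt (2 * Real.pi))⁻¹ * Real.exp (-(x ^ 2 / 2)) := by
    intro x
    simp [gaussianPDFReal, neg_div]
  rw [gaussTail, hset, probReal_compl_eq_one_sub measurableSet_Icc, measureReal_def,
    gaussianReal_apply_eq_integral _ one_ne_zero, ENNReal.toReal_ofReal
      (integral_nonneg fun x => gaussianPDFReal_nonneg _ _ _),
    integral_Icc_eq_integral_Ioc, ← intervalIntegral.integral_of_le (by linarith)]
  congr 1
  simp only [hpdf]
  rw [intervalIntegral.integral_const_mul]
  have hsub := intervalIntegral.integral_comp_mul_right (a := -t) (b := t)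
    (fun x : ℝ => Real.exp (-(x ^ 2 / 2))) h3.ne'
  rw [neg_mul] at hsub
  have hsub' : ∫ x in (-(t * Real.sqrt 3))..(t * Real.sqrt 3), Real.exp (-(x ^ 2 / 2)) =
      Real.sqrt 3 * ∫ v in (-t)..t, Real.exp (-(3 / 2 * v ^ 2)) := by
    have e : ∀ v : ℝ, Real.exp (-((v * Real.sqrt 3) ^ 2 / 2)) = Real.exp (-(3 / 2 * v ^ 2)) := by
      intro v
      rw [mul_pow, Real.sq_sqrt (by norm_num)]; ring_nf
    simp only [e, smul_eq_mul] at hsub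
    rw [hsub, ← mul_assoc, mul_inv_cancel₀ h3.ne', one_mul]
  have hsplit : ∫ v in (-t)..t, Real.exp (-(3 / 2 * v ^ 2)) = 2 * gaussInt t := by
    rw [← intervalIntegral.integral_add_adjacent_intervals (b := 0)
      (continuous_gaussDensity.intervalIntegrable _ _)
      (continuous_gaussDensity.intervalIntegrable _ _), intervalIntegral.integral_symm]
    change -gaussInt (-t) + gaussInt t = _
    rw [gaussInt_neg]; ring
  rw [hsub', hsplit]
  have hc : gaussScale = (Real.sqrt (2 * Real.pi))⁻¹ * Real.sqrt 3 * 2 := by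
    rw [gaussScale, Real.sqrt_eq_iff_mul_self_eq (by positivity) (by positivity)]
    have e1 : Real.sqrt (2 * Real.pi) ^ 2 = 2 * Real.pi := Real.sq_sqrt (by positivity)
    have e2 : Real.sqrt 3 ^ 2 = 3 := Real.sq_sqrt (by norm_num)
    have : Real.sqrt (2 * Real.pi) ≠ 0 := (Real.sqrt_pos.2 (by positivity)).ne'
    have := Real.pi_pos.ne'
    field_simp
    rw [mul_comm Real.pi 2, e1, e2]; ring
  rw [hc]; ring

theorem two_mul_upperTail_eq {t : ℝ} (ht : 0 ≤ t) :
    2 * upperTail t = gaussTail (t * Real.sqrt 3) := by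
  rw [gaussTail_mul_sqrt_three ht, upperTail]; ring

theorem gaussTail_nonneg (s : ℝ) : 0 ≤ gaussTail s := measureReal_nonneg

/-- The Taylor polynomials of `gaussInt`. -/
theorem integral_gaussTaylor (n : ℕ) (t : ℝ) :
    ∫ v in (0 : ℝ)..t, ∑ k ∈ Finset.range n, (-(3 / 2 * v ^ 2)) ^ k / (k.factorial : ℝ) =
      ∑ k ∈ Finset.range n, (-(3 / 2)) ^ k * t ^ (2 * k + 1) / ((2 * k + 1) * k.factorial) := by
  rw [intervalIntegral.integral_finsetSum
    (fun k _ => Continuous.intervalIntegrable (by fun_prop) _ _)]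
  apply Finset.sum_congr rfl
  intro k _
  have : ∀ v : ℝ, (-(3 / 2 * v ^ 2)) ^ k / (k.factorial : ℝ) =
      (-(3 / 2)) ^ k / (k.factorial : ℝ) * v ^ (2 * k) := by
    intro v
    rw [pow_mul, ← neg_mul, mul_pow]; ring
  simp only [this]
  rw [intervalIntegral.integral_const_mul, integral_pow]
  push_cast
  simp
  field_simp

theorem le_gaussInt (m : ℕ) {t : ℝ} (ht : 0 ≤ t) :
    ∑ k ∈ Finset.range (2 * m), (-(3 / 2)) ^ k * t ^ (2 * k + 1) / ((2 * k + 1) * k.factorial)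
      ≤ gaussInt t := by
  rw [← integral_gaussTaylor]
  exact intervalIntegral.integral_mono_on ht (Continuous.intervalIntegrable (by fun_prop) _ _)
    (continuous_gaussDensity.intervalIntegrable _ _) fun v _ => sum_le_exp_of_even m _

theorem gaussInt_le (m : ℕ) {t : ℝ} (ht : 0 ≤ t) :
    gaussInt t ≤ ∑ k ∈ Finset.range (2 * m + 1),
      (-(3 / 2)) ^ k * t ^ (2 * k + 1) / ((2 * k + 1) * k.factorial) := by
  rw [← integral_gaussTaylor]
  exact intervalIntegral.integral_mono_on ht (continuous_gaussDensity.intervalIntegrable _ _)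
    (Continuous.intervalIntegrable (by fun_prop) _ _)
    fun v _ => exp_le_sum_of_odd m (by nlinarith [sq_nonneg v])

/-- `gaussInt` lies below its tangents on the half-line. -/
theorem gaussInt_le_tangent {m t : ℝ} (hm : 0 ≤ m) (ht : 0 ≤ t) :
    gaussInt t ≤ gaussInt m + Real.exp (-(3 / 2 * m ^ 2)) * (t - m) := by
  have hd : ∀ u v, gaussInt v - gaussInt u = ∫ x in u..v, Real.exp (-(3 / 2 * x ^ 2)) := by
    intro u v
    exact intervalIntegral.integral_interval_sub_left
      (continuous_gaussDensity.intervalIntegrable _ _)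
      (continuous_gaussDensity.intervalIntegrable _ _)
  rcases le_total m t with h | h
  · have h1 := intervalIntegral.integral_mono_on (μ := volume) h
      (continuous_gaussDensity.intervalIntegrable m t)
      (g := fun _ => Real.exp (-(3 / 2 * m ^ 2))) (by simp) (fun x hx => by
        apply Real.exp_le_exp.2
        have := hx.1
        nlinarith)
    rw [← hd] at h1
    simp at h1
    nlinarith
  · have h1 := intervalIntegral.integral_mono_on (μ := volume) h
      (f := fun _ => Real.exp (-(3 / 2 * m ^ 2))) (by simp)
      (continuous_gaussDensity.intervalIntegrable t m) (fun x hx => by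
        apply Real.exp_le_exp.2
        have := hx.1
        have := hx.2
        nlinarith)
    rw [← hd] at h1
    simp at h1
    nlinarith

theorem gaussScale_mul_gaussInt_one_lt : gaussScale * gaussInt 1 < 1 := by
  have h1 := gaussInt_le 4 (t := 1) (by norm_num)
  norm_num [Finset.sum_range_succ, Nat.factorial] at h1
  have h2 := gaussScale_lt
  have h3 := gaussScale_pos
  nlinarith

theorem tailRatio_eq {t : ℝ} (ht : 0 ≤ t) :
    tailRatio t = (1 - t) / (1 - gaussScale * gaussInt t) := by
  rw [tailRatio, gaussTail_mul_sqrt_three ht]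

theorem one_sub_gaussInt_pos {t : ℝ} (ht : t ≤ 1) : 0 < 1 - gaussScale * gaussInt t := by
  have h1 := gaussInt_mono ht
  have := gaussScale_mul_gaussInt_one_lt
  have := mul_le_mul_of_nonneg_left h1 gaussScale_pos.le
  linarith

/-- The numerator of the derivative of `tailRatio`. -/
noncomputable def tailRatioSlope (t : ℝ) : ℝ :=
  (1 - t) * (gaussScale * Real.exp (-(3 / 2 * t ^ 2))) - (1 - gaussScale * gaussInt t)

/-- The derivatives of `1 - t` and of the Gaussian tail contribute opposite multiples of the density
and cancel. Only the derivative of the density survives, so the sign on `(0, 1)` is evident. -/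
theorem hasDerivAt_tailRatioSlope (t : ℝ) : HasDerivAt tailRatioSlope
    (-(3 * t * (1 - t) * (gaussScale * Real.exp (-(3 / 2 * t ^ 2))))) t := by
  have h1 : HasDerivAt (fun t : ℝ => Real.exp (-(3 / 2 * t ^ 2)))
      (Real.exp (-(3 / 2 * t ^ 2)) * (-(3 * t))) t := by
    have := (((hasDerivAt_pow 2 t).const_mul (3 / 2)).neg).exp
    exact this.congr_deriv (by norm_num; ring)
  have h2 := (((hasDerivAt_id t).const_sub 1).mul (h1.const_mul gaussScale)).sub
    (((hasDerivAt_gaussInt t).const_mul gaussScale).const_sub 1)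
  exact h2.congr_deriv (by simp; ring)

theorem tailRatioSlope_strictAntiOn : StrictAntiOn tailRatioSlope (Set.Icc 0 1) := by
  apply strictAntiOn_of_deriv_neg (convex_Icc 0 1)
  · exact fun x _ => (hasDerivAt_tailRatioSlope x).continuousAt.continuousWithinAt
  · intro x hx
    rw [interior_Icc] at hx
    rw [(hasDerivAt_tailRatioSlope x).deriv]
    have := gaussScale_pos
    have := Real.exp_pos (-(3 / 2 * x ^ 2))
    have h1 := hx.1
    have h2 : 0 < 1 - x := by linarith [hx.2]
    have : 0 < 3 * x * (1 - x) * (gaussScale * Real.exp (-(3 / 2 * x ^ 2))) := by positivity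
    linarith

theorem tailRatioSlope_pos : 0 < tailRatioSlope 0.642908 := by
  have h1 := le_gaussInt 7 (t := 0.642908) (by norm_num)
  have h2 := sum_le_exp_of_even 7 (-(3 / 2 * 0.642908 ^ 2))
  norm_num [Finset.sum_range_succ, Nat.factorial] at h1 h2
  have h3 := gaussScale_gt
  rw [tailRatioSlope]
  norm_num
  nlinarith

theorem tailRatioSlope_neg : tailRatioSlope 0.642909 < 0 := by
  have h1 := gaussInt_le 7 (t := 0.642909) (by norm_num)
  have h2 := exp_le_sum_of_odd 7 (x := -(3 / 2 * 0.642909 ^ 2)) (by norm_num)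
  norm_num [Finset.sum_range_succ, Nat.factorial] at h1 h2
  have h3 := gaussScale_lt
  have h4 := gaussScale_pos
  rw [tailRatioSlope]
  norm_num
  nlinarith

theorem hasDerivAt_tailRatio {t : ℝ} (h0 : 0 < t) (h1 : t < 1) : HasDerivAt tailRatio
    (tailRatioSlope t / (1 - gaussScale * gaussInt t) ^ 2) t := by
  have hp := one_sub_gaussInt_pos h1.le
  have h2 := ((hasDerivAt_id t).const_sub 1).div
    (((hasDerivAt_gaussInt t).const_mul gaussScale).const_sub 1) hp.ne'
  have h3 : HasDerivAt (fun t => (1 - t) / (1 - gaussScale * gaussInt t))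
      (tailRatioSlope t / (1 - gaussScale * gaussInt t) ^ 2) t :=
    h2.congr_deriv (by simp [tailRatioSlope]; ring)
  apply h3.congr_of_eventuallyEq
  filter_upwards [lt_mem_nhds h0] with x hx
  exact tailRatio_eq (le_of_lt hx)

/-- `tailRatio` has a unique maximum on `(0, 1)`. -/
theorem exists_unique_max_tailRatio : ∃ t₀ : ℝ, 0.642908 ≤ t₀ ∧ t₀ < 0.642909 ∧
    ∀ t ∈ Set.Ioo (0 : ℝ) 1, t ≠ t₀ → tailRatio t < tailRatio t₀ := by
  have hcont : ContinuousOn tailRatioSlope (Set.Icc 0.642908 0.642909) :=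
    fun x _ => (hasDerivAt_tailRatioSlope x).continuousAt.continuousWithinAt
  obtain ⟨t₀, ht₀, hz⟩ := intermediate_value_Icc' (by norm_num) hcont
    ⟨tailRatioSlope_neg.le, tailRatioSlope_pos.le⟩
  have hlt : t₀ < 0.642909 := by
    refine lt_of_le_of_ne ht₀.2 ?_
    rintro rfl
    exact absurd hz tailRatioSlope_neg.ne
  have h0 : 0 < t₀ := by linarith [ht₀.1]
  have h1 : t₀ < 1 := by linarith
  refine ⟨t₀, ht₀.1, hlt, fun t ht hne => ?_⟩
  rcases lt_or_gt_of_ne hne with h | h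
  · have hmono : StrictMonoOn tailRatio (Set.Icc t t₀) := by
      apply strictMonoOn_of_deriv_pos (convex_Icc _ _)
      · exact fun x hx => (hasDerivAt_tailRatio (ht.1.trans_le hx.1)
          (hx.2.trans_lt h1)).continuousAt.continuousWithinAt
      · intro x hx
        rw [interior_Icc] at hx
        have hx1 : x < 1 := hx.2.trans h1
        have hx0 : 0 < x := ht.1.trans hx.1
        rw [(hasDerivAt_tailRatio hx0 hx1).deriv]
        have := tailRatioSlope_strictAntiOn ⟨hx0.le, hx1.le⟩ ⟨h0.le, h1.le⟩ hx.2
        rw [hz] at this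
        exact div_pos this (pow_pos (one_sub_gaussInt_pos hx1.le) 2)
    exact hmono ⟨le_rfl, h.le⟩ ⟨h.le, le_rfl⟩ h
  · have hanti : StrictAntiOn tailRatio (Set.Icc t₀ t) := by
      apply strictAntiOn_of_deriv_neg (convex_Icc _ _)
      · exact fun x hx => (hasDerivAt_tailRatio (h0.trans_le hx.1)
          (hx.2.trans_lt ht.2)).continuousAt.continuousWithinAt
      · intro x hx
        rw [interior_Icc] at hx
        have hx1 : x < 1 := hx.2.trans ht.2
        have hx0 : 0 < x := h0.trans hx.1
        rw [(hasDerivAt_tailRatio hx0 hx1).deriv]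
        have := tailRatioSlope_strictAntiOn ⟨h0.le, h1.le⟩ ⟨hx0.le, hx1.le⟩ hx.1
        rw [hz] at this
        exact div_neg_of_neg_of_pos this (pow_pos (one_sub_gaussInt_pos hx1.le) 2)
    exact hanti ⟨le_rfl, h.le⟩ ⟨h.le, le_rfl⟩ h

theorem le_tailRatio : 1.345118 ≤ tailRatio 0.642908 := by
  rw [tailRatio_eq (by norm_num), le_div_iff₀ (one_sub_gaussInt_pos (by norm_num))]
  have h1 := le_gaussInt 7 (t := 0.642908) (by norm_num)
  norm_num [Finset.sum_range_succ, Nat.factorial] at h1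
  have h3 := gaussScale_gt
  nlinarith

theorem tailRatio_lt {t : ℝ} (h0 : 0.642908 ≤ t) (h1 : t < 0.642909) :
    tailRatio t < 1.345119 := by
  rw [tailRatio_eq (by linarith), div_lt_iff₀ (one_sub_gaussInt_pos (by linarith))]
  have h2 := gaussInt_le_tangent (m := 0.642909) (t := t) (by norm_num) (by linarith)
  have h3 := gaussInt_le 7 (t := 0.642909) (by norm_num)
  have h4 := sum_le_exp_of_even 7 (-(3 / 2 * 0.642909 ^ 2))
  norm_num [Finset.sum_range_succ, Nat.factorial] at h2 h3 h4
  have h5 := gaussScale_lt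
  have h6 := gaussScale_gt
  -- This is the tangent at `0.642909` with rational coefficients. As `t` lies to the left of that
  -- point, rounding the slope down keeps an upper bound.
  have h7 : gaussInt t ≤ 0.5315055018 - 0.5379 * (0.642909 - t) := by nlinarith
  nlinarith

theorem exists_cStar_maximizer : ∃ t₀ : ℝ, 0.642908 ≤ t₀ ∧ t₀ < 0.642909 ∧
    tailRatio t₀ = cStar ∧ ∀ t ∈ Set.Ioo (0 : ℝ) 1, t ≠ t₀ → tailRatio t < cStar := by
  obtain ⟨t₀, h0, h1, h2⟩ := exists_unique_max_tailRatio
  have hmem : t₀ ∈ Set.Ioo (0 : ℝ) 1 := ⟨by linarith, by linarith⟩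
  have hg : IsGreatest (tailRatio '' Set.Ioo (0 : ℝ) 1) (tailRatio t₀) := by
    refine ⟨⟨t₀, hmem, rfl⟩, ?_⟩
    rintro _ ⟨t, ht, rfl⟩
    by_cases h : t = t₀
    · rw [h]
    · exact (h2 t ht h).le
  have he : cStar = tailRatio t₀ := hg.csSup_eq
  exact ⟨t₀, h0, h1, he.symm, by rwa [he]⟩

theorem tailRatio_le_cStar {t : ℝ} (ht : t ∈ Set.Ioo (0 : ℝ) 1) : tailRatio t ≤ cStar := by
  obtain ⟨t₀, -, -, h2, h3⟩ := exists_cStar_maximizer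
  by_cases h : t = t₀
  · rw [h, h2]
  · exact (h3 t ht h).le

theorem le_cStar : 1.345118 ≤ cStar :=
  le_tailRatio.trans (tailRatio_le_cStar ⟨by norm_num, by norm_num⟩)

theorem cStar_lt : cStar < 1.345119 := by
  obtain ⟨t₀, h0, h1, h2, -⟩ := exists_cStar_maximizer
  rw [← h2]
  exact tailRatio_lt h0 h1

theorem one_sub_le_cStar_mul {t : ℝ} (ht : t ∈ Set.Ioo (0 : ℝ) 1) :
    1 - t ≤ cStar * (1 - gaussScale * gaussInt t) := by
  have := tailRatio_le_cStar ht
  rwa [tailRatio_eq ht.1.le, div_le_iff₀ (one_sub_gaussInt_pos ht.2.le)] at this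

/-! ### Replacing a Gaussian component by a uniform one -/

/-- With `θ = X * η` and `A = (X - η) ^ 2 - 1` the left side is `A + 4 * θ`. The quintic minorant of
`exp (2 * θ)` has a factor `2 * θ` after subtracting `1`, so `2 ≤ P(θ) * A` suffices for a quartic
`P` with positive coefficients. This is monotone in `X` and is checked at the lower bound `l`. -/
theorem exp_reflection_of_le {X η l : ℝ} (hη : 0 ≤ η) (hl : 1 + η ≤ l) (hlX : l ≤ X)
    (hpoly : 2 ≤ (1 + l * η + 2 / 3 * (l * η) ^ 2 + 1 / 3 * (l * η) ^ 3 + 2 / 15 * (l * η) ^ 4) *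
      ((l - η) ^ 2 - 1)) :
    (X + η) ^ 2 - 1 ≤ Real.exp (2 * (X * η)) * ((X - η) ^ 2 - 1) := by
  have hl0 : 0 ≤ l := by linarith
  have h1 : l * η ≤ X * η := mul_le_mul_of_nonneg_right hlX hη
  have h0 : 0 ≤ l * η := by positivity
  have h2 : (l - η) ^ 2 - 1 ≤ (X - η) ^ 2 - 1 := by nlinarith
  have h3 : 0 ≤ (l - η) ^ 2 - 1 := by nlinarith
  set θ := X * η with hθ
  have h4 : 1 + l * η + 2 / 3 * (l * η) ^ 2 + 1 / 3 * (l * η) ^ 3 + 2 / 15 * (l * η) ^ 4 ≤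
      1 + θ + 2 / 3 * θ ^ 2 + 1 / 3 * θ ^ 3 + 2 / 15 * θ ^ 4 := by gcongr
  have hθ0 : 0 ≤ θ := h0.trans h1
  have h5 : 2 ≤ (1 + θ + 2 / 3 * θ ^ 2 + 1 / 3 * θ ^ 3 + 2 / 15 * θ ^ 4) * ((X - η) ^ 2 - 1) :=
    hpoly.trans (mul_le_mul h4 h2 h3 (by positivity))
  have h6 := quintic_le_exp (2 * θ)
  have h7 : 0 ≤ (X - η) ^ 2 - 1 := h3.trans h2
  have h8 := mul_le_mul_of_nonneg_right h6 h7
  have h9 := mul_le_mul_of_nonneg_left h5 (by linarith : 0 ≤ 2 * θ)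
  have e : (X + η) ^ 2 - 1 = ((X - η) ^ 2 - 1) + 4 * θ := by rw [hθ]; ring
  rw [e]
  nlinarith

/-- The claim says that the second derivative of `exp (-x² / 2)` at `X - η` is at least that at `X +
η`. The constant is `3.3075 = 3 * 1.05²`. -/
theorem exp_reflection {X η : ℝ} (hX : 0 ≤ X) (hη : 0 ≤ η) (hη1 : η ≤ 1)
    (h : 3.3075 * (1 + η ^ 2 / 3) ≤ X ^ 2) :
    (X + η) ^ 2 - 1 ≤ Real.exp (2 * (X * η)) * ((X - η) ^ 2 - 1) := by
  rcases le_total η 0.35 with h1 | h1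
  · apply exp_reflection_of_le (l := 1.8186) hη (by linarith)
    · nlinarith [sq_nonneg η]
    · obtain ⟨s, rfl⟩ : ∃ s, η = 0.35 * s := ⟨η / 0.35, by ring⟩
      have h2 : 0 ≤ s := by linarith
      have h3 : 0 ≤ 1 - s := by linarith
      have key : ∀ i j : ℕ, 0 ≤ s ^ i * (1 - s) ^ j :=
        fun i j => mul_nonneg (pow_nonneg h2 i) (pow_nonneg h3 j)
      have k0 := key 0 6
      have k1 := key 1 5
      have k2 := key 2 4
      have k3 := key 3 3
      have k4 := key 4 2
      have k5 := key 5 1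
      have k6 := key 6 0
      ring_nf at k0 k1 k2 k3 k4 k5 k6 ⊢
      linarith
  · have hX2 : 1.6137 + 0.4841 * η ≤ X := by
      -- The lower bound for `X` is the tangent at `η = 0.9`, rounded down, of the convex function
      -- `√(3.3075 * (1 + η² / 3))`. With it the polynomial has degree ten, hence the Bernstein
      -- products of that degree below.
      apply (pow_le_pow_iff_left₀ (by linarith) hX two_ne_zero).1
      nlinarith [sq_nonneg (η - 0.9)]
    apply exp_reflection_of_le (l := 1.6137 + 0.4841 * η) hη (by linarith) hX2
    obtain ⟨s, rfl⟩ : ∃ s, η = 0.35 + 0.65 * s := ⟨(η - 0.35) / 0.65, by ring⟩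
    have h2 : 0 ≤ s := by linarith
    have h3 : 0 ≤ 1 - s := by linarith
    have key : ∀ i j : ℕ, 0 ≤ s ^ i * (1 - s) ^ j :=
      fun i j => mul_nonneg (pow_nonneg h2 i) (pow_nonneg h3 j)
    have k0 := key 0 10
    have k1 := key 1 9
    have k2 := key 2 8
    have k3 := key 3 7
    have k4 := key 4 6
    have k5 := key 5 5
    have k6 := key 6 4
    have k7 := key 7 3
    have k8 := key 8 2
    have k9 := key 9 1
    have k10 := key 10 0
    ring_nf at k0 k1 k2 k3 k4 k5 k6 k7 k8 k9 k10 ⊢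
    linarith

/-- Up to a positive factor the integral is the derivative in `s` of the averaged `gaussInt ((t - s
* u) / √(1 - s²))`. Integrating by parts turns it into the integral of the odd kernel `(u - u³) / 6`
against the second derivative `w₂` of the weight, and pairing `u` with `-u` leaves `w₂ (-u) ≤ w₂ u`.
-/
theorem smoothing_slope_nonneg {s t κ : ℝ} (hs : 0 ≤ s) (hs2 : s ≤ 1 / 2) (ht : 1.05 ≤ t)
    (hκ : κ * (1 - s ^ 2) = 1) :
    0 ≤ ∫ u in (-1 : ℝ)..1, Real.exp (-(3 / 2 * (κ * (t - s * u) ^ 2))) *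
      (κ * s * (t - s * u) - u) := by
  have hκ0 : 0 < κ := by
    by_contra hc
    have h1 : 0 ≤ 1 - s ^ 2 := by nlinarith
    have := mul_nonpos_of_nonpos_of_nonneg (not_lt.1 hc) h1
    linarith
  set w : ℝ → ℝ := fun u => Real.exp (-(3 / 2 * (κ * (t - s * u) ^ 2))) with hw
  set w₁ : ℝ → ℝ := fun u => w u * (3 * κ * s * (t - s * u)) with hw₁
  set w₂ : ℝ → ℝ := fun u => w u * ((3 * κ * s * (t - s * u)) ^ 2 - 3 * κ * s ^ 2) with hw₂
  have hl : ∀ u, HasDerivAt (fun u : ℝ => t - s * u) (-s) u := fun u => by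
    simpa using ((hasDerivAt_id u).const_mul s).const_sub t
  have hdw : ∀ u, HasDerivAt w (w₁ u) u := by
    intro u
    have := ((((hl u).pow 2).const_mul κ).const_mul (3 / 2)).neg.exp
    exact this.congr_deriv (by simp [hw₁, hw]; ring)
  have hdw₁ : ∀ u, HasDerivAt w₁ (w₂ u) u := by
    intro u
    have := (hdw u).mul ((hl u).const_mul (3 * κ * s))
    exact this.congr_deriv (by simp only [hw₂, hw₁]; ring)
  have hwc : Continuous w := by fun_prop
  have hw₂c : Continuous w₂ := by fun_prop
  -- The primitive below combines the integrations by parts; it vanishes at `±1` because `u - u³`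
  -- and `1 - u²` do.
  have hB : ∫ u in (-1 : ℝ)..1, (w u * (κ * s * (t - s * u) - u) - (u - u ^ 3) / 6 * w₂ u) = 0 := by
    rw [intervalIntegral.integral_eq_sub_of_hasDerivAt
      (f := fun u => -((u - u ^ 3) / 6 * w₁ u) + (1 - u ^ 2) / 2 * w u) _
      (Continuous.intervalIntegrable (by fun_prop) _ _)]
    · norm_num
    · intro u _
      have h1 : HasDerivAt (fun u : ℝ => (u - u ^ 3) / 6) ((1 - 3 * u ^ 2) / 6) u := by
        have := ((hasDerivAt_id u).sub (hasDerivAt_pow 3 u)).div_const 6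
        exact this.congr_deriv (by norm_num)
      have h2 : HasDerivAt (fun u : ℝ => (1 - u ^ 2) / 2) (-u) u := by
        have := ((hasDerivAt_pow 2 u).const_sub 1).div_const 2
        exact this.congr_deriv (by norm_num; ring)
      exact ((h1.mul (hdw₁ u)).neg.add (h2.mul (hdw u))).congr_deriv
        (by simp only [hw₁]; ring)
  rw [intervalIntegral.integral_sub (Continuous.intervalIntegrable (by fun_prop) _ _)
    (Continuous.intervalIntegrable (by fun_prop) _ _), sub_eq_zero] at hB
  rw [hB, ← intervalIntegral.integral_add_adjacent_intervals (b := 0)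
    (Continuous.intervalIntegrable (by fun_prop) _ _)
    (Continuous.intervalIntegrable (by fun_prop) _ _)]
  have hneg := intervalIntegral.integral_comp_neg (a := 0) (b := 1)
    (fun u : ℝ => (u - u ^ 3) / 6 * w₂ u)
  rw [neg_zero] at hneg
  rw [← hneg, ← intervalIntegral.integral_add (Continuous.intervalIntegrable (by fun_prop) _ _)
    (Continuous.intervalIntegrable (by fun_prop) _ _)]
  apply intervalIntegral.integral_nonneg (by norm_num)
  intro u hu
  have hu0 := hu.1
  have hu1 := hu.2
  have key : w₂ (-u) ≤ w₂ u := by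
    set r := Real.sqrt (3 * κ) with hr
    have hr2 : r ^ 2 = 3 * κ := Real.sq_sqrt (by positivity)
    have hr0 : 0 ≤ r := Real.sqrt_nonneg _
    have hsu : 0 ≤ s * u := by positivity
    have hsu1 : s * u ≤ s := by nlinarith
    have hκs : κ = 1 + κ * s ^ 2 := by linarith
    have hs4 : s ^ 2 ≤ 1 / 4 := by nlinarith
    have hκle : κ ≤ 4 / 3 := by nlinarith
    -- Since `κ = 1 + κ * s²`, one has `1 + η² / 3 = 1 + κ * (s * u)² ≤ κ`, and `X² = 3 * κ * t² ≥
    -- 3.3075 * κ` by `1.05 ≤ t`.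
    have hcore := exp_reflection (X := r * t) (η := r * (s * u)) (by positivity) (by positivity)
      (by
        apply (pow_le_pow_iff_left₀ (by positivity) zero_le_one two_ne_zero).1
        rw [mul_pow, hr2]
        have : (s * u) ^ 2 ≤ s ^ 2 := by nlinarith
        nlinarith)
      (by
        rw [mul_pow, mul_pow, hr2]
        have h1 : (s * u) ^ 2 ≤ s ^ 2 := by nlinarith
        have h2 : (1.1025 : ℝ) ≤ t ^ 2 := by nlinarith
        have h3 : 1 + 3 * κ * (s * u) ^ 2 / 3 ≤ κ := by nlinarith
        nlinarith)
    have hexp : w u = w (-u) * Real.exp (2 * (r * t * (r * (s * u)))) := by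
      simp only [hw]
      rw [← Real.exp_add]
      congr 1
      have : r * t * (r * (s * u)) = 3 * κ * (t * (s * u)) := by rw [← hr2]; ring
      rw [this]; ring
    have e1 : w₂ (-u) = 3 * κ * s ^ 2 * (w (-u) * ((r * t + r * (s * u)) ^ 2 - 1)) := by
      have : (r * t + r * (s * u)) ^ 2 = 3 * κ * (t + s * u) ^ 2 := by rw [← hr2]; ring
      simp only [hw₂]
      rw [this]; ring
    have e2 : w₂ u = 3 * κ * s ^ 2 * (w (-u) * (Real.exp (2 * (r * t * (r * (s * u)))) *
        ((r * t - r * (s * u)) ^ 2 - 1))) := by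
      have : (r * t - r * (s * u)) ^ 2 = 3 * κ * (t - s * u) ^ 2 := by rw [← hr2]; ring
      simp only [hw₂]
      rw [this, hexp]; ring
    rw [e1, e2]
    have : 0 < w (-u) := Real.exp_pos _
    gcongr
  have h1 : 0 ≤ (u - u ^ 3) / 6 := by
    have : 0 ≤ u * (1 - u ^ 2) := mul_nonneg hu0 (by nlinarith)
    linarith
  have h2 := mul_nonneg h1 (sub_nonneg.2 key)
  have e : (-u - (-u) ^ 3) / 6 * w₂ (-u) + (u - u ^ 3) / 6 * w₂ u =
      (u - u ^ 3) / 6 * (w₂ u - w₂ (-u)) := by ring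
  rw [e]
  exact h2

/-- Replacing a Gaussian component of variance `a²/3` by a uniform one does not increase the
tail at `t`. -/
theorem upperTail_smoothing {a t : ℝ} (ha : 0 ≤ a) (ha2 : a ≤ 1 / 2) (ht : 1.05 ≤ t) :
    (1 / 2) * ∫ u in (-1 : ℝ)..1, upperTail ((t - a * u) / Real.sqrt (1 - a ^ 2)) ≤
      upperTail t := by
  -- `f` follows a path of constant total variance, from the Gaussian at `s = 0` to the mixture with
  -- uniform coefficient `a` at `s = a`. It is shown to be increasing, and the tail is decreasing in
  -- `f`.
  set f : ℝ → ℝ := fun s => ∫ u in (-1 : ℝ)..1, gaussInt ((t - s * u) / Real.sqrt (1 - s ^ 2))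
    with hf
  set F' : ℝ → ℝ → ℝ := fun s u =>
    Real.exp (-(3 / 2 * ((t - s * u) / Real.sqrt (1 - s ^ 2)) ^ 2)) *
      ((-u * Real.sqrt (1 - s ^ 2) - (t - s * u) * (-(2 * s) / (2 * Real.sqrt (1 - s ^ 2)))) /
        Real.sqrt (1 - s ^ 2) ^ 2) with hF'
  -- An open interval around `[0, 1/2]` on which the standard deviation stays away from zero;
  -- differentiation under the integral needs a neighbourhood of each `s`.
  have hpos : ∀ s : ℝ, s ∈ Set.Ioo (-0.6 : ℝ) 0.6 → 0.8 ≤ Real.sqrt (1 - s ^ 2) := by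
    intro s hs
    apply Real.le_sqrt_of_sq_le
    nlinarith [hs.1, hs.2]
  have hpt : ∀ s ∈ Set.Ioo (-0.6 : ℝ) 0.6, ∀ u, HasDerivAt
      (fun s => gaussInt ((t - s * u) / Real.sqrt (1 - s ^ 2))) (F' s u) s := by
    intro s hs u
    have h0 := hpos s hs
    have h1 : HasDerivAt (fun s : ℝ => t - s * u) (-u) s := by
      simpa using ((hasDerivAt_id s).mul_const u).const_sub t
    have h2 : HasDerivAt (fun s : ℝ => 1 - s ^ 2) (-(2 * s)) s := by
      simpa using (hasDerivAt_pow 2 s).const_sub 1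
    have h3 := h2.sqrt (by nlinarith [hs.1, hs.2])
    exact (hasDerivAt_gaussInt _).comp s (h1.div h3 (by linarith))
  have hF'c : ∀ s, Continuous (F' s) := by intro s; fun_prop
  have hFc : ∀ s, Continuous fun u => gaussInt ((t - s * u) / Real.sqrt (1 - s ^ 2)) := by
    intro s
    exact continuous_gaussInt.comp (by fun_prop)
  have hder : ∀ s ∈ Set.Ioo (-0.6 : ℝ) 0.6, HasDerivAt f (∫ u in (-1 : ℝ)..1, F' s u) s := by
    intro s hs
    refine (intervalIntegral.hasDerivAt_integral_of_dominated_loc_of_deriv_le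
      (bound := fun _ => (1 + (t + 1)) / 0.64)
      (isOpen_Ioo.mem_nhds hs) (Filter.Eventually.of_forall fun s => (hFc s).aestronglyMeasurable)
      ((hFc s).intervalIntegrable _ _) (hF'c s).aestronglyMeasurable ?_ (by simp) ?_).2
    · refine Filter.Eventually.of_forall fun u hu s hs => ?_
      rw [Set.uIoc_of_le (by norm_num)] at hu
      have h0 := hpos s hs
      set σ := Real.sqrt (1 - s ^ 2) with hσ
      have hσ1 : σ ≤ 1 := by
        rw [hσ]; apply Real.sqrt_le_one.2; nlinarith [sq_nonneg s]
      have hs6 : |s| ≤ 0.6 := abs_le.2 ⟨hs.1.le, hs.2.le⟩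
      have hu1 : |u| ≤ 1 := abs_le.2 ⟨hu.1.le, hu.2⟩
      simp only [hF']
      rw [← hσ, Real.norm_eq_abs, abs_mul, Real.abs_exp, abs_div]
      have e1 : Real.exp (-(3 / 2 * ((t - s * u) / σ) ^ 2)) ≤ 1 := by
        rw [Real.exp_le_one_iff]
        nlinarith [sq_nonneg ((t - s * u) / σ)]
      have hsu : |s * u| ≤ 1 := by
        rw [abs_mul]
        nlinarith [abs_nonneg s, abs_nonneg u]
      have e2 : |-u * σ - (t - s * u) * (-(2 * s) / (2 * σ))| ≤ 1 + (t + 1) := by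
        refine (abs_sub _ _).trans (add_le_add ?_ ?_)
        · rw [abs_mul, abs_neg, abs_of_nonneg (by linarith : (0 : ℝ) ≤ σ)]
          nlinarith [abs_nonneg u]
        · rw [abs_mul]
          have e3 : |t - s * u| ≤ t + 1 := by
            refine (abs_sub _ _).trans ?_
            rw [abs_of_nonneg (by linarith : (0 : ℝ) ≤ t)]
            linarith
          have e4 : |-(2 * s) / (2 * σ)| ≤ 1 := by
            rw [abs_div, abs_neg, abs_mul, abs_mul, abs_of_nonneg (by linarith : (0 : ℝ) ≤ σ),
              abs_two, div_le_one (by linarith)]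
            linarith
          calc _ ≤ (t + 1) * 1 := mul_le_mul e3 e4 (abs_nonneg _) (by linarith)
            _ = _ := mul_one _
      have e5 : 0.64 ≤ |σ ^ 2| := by
        rw [abs_of_nonneg (sq_nonneg σ)]; nlinarith
      calc _ ≤ 1 * ((1 + (t + 1)) / 0.64) := by
            apply mul_le_mul e1 _ (by positivity) zero_le_one
            exact div_le_div₀ (by linarith) e2 (by norm_num) e5
        _ = _ := one_mul _
    · exact Filter.Eventually.of_forall fun u _ s hs => hpt s hs u
  have hmono : MonotoneOn f (Set.Icc 0 (1 / 2)) := by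
    have hsub : ∀ s ∈ Set.Icc (0 : ℝ) (1 / 2), s ∈ Set.Ioo (-0.6 : ℝ) 0.6 := by
      intro s hs
      constructor
      · linarith [hs.1]
      · have := hs.2; norm_num at this ⊢; linarith
    apply monotoneOn_of_deriv_nonneg (convex_Icc _ _)
    · exact fun s hs => (hder s (hsub s hs)).continuousAt.continuousWithinAt
    · exact fun s hs =>
        (hder s (hsub s (interior_subset hs))).differentiableAt.differentiableWithinAt
    · intro s hs
      have hs' := interior_subset hs
      rw [(hder s (hsub s hs')).deriv]
      have h0 := hpos s (hsub s hs')
      set σ := Real.sqrt (1 - s ^ 2) with hσ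
      have hσ2 : σ ^ 2 = 1 - s ^ 2 := Real.sq_sqrt (by nlinarith [hs'.1, hs'.2])
      have hσ0 : 0 < σ := by linarith
      have := smoothing_slope_nonneg (κ := (σ ^ 2)⁻¹) hs'.1 hs'.2 ht
        (by rw [← hσ2]; exact inv_mul_cancel₀ (by positivity))
      have e : ∀ u, F' s u = σ⁻¹ * (Real.exp (-(3 / 2 * ((σ ^ 2)⁻¹ * (t - s * u) ^ 2))) *
          ((σ ^ 2)⁻¹ * s * (t - s * u) - u)) := by
        intro u
        simp only [hF']
        rw [← hσ, div_pow, div_eq_inv_mul (_ ^ 2) (_ ^ 2)]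
        field_simp
        ring
      simp only [e]
      rw [intervalIntegral.integral_const_mul]
      exact mul_nonneg (by positivity) this
  have hfin := hmono ⟨le_rfl, by norm_num⟩ ⟨ha, ha2⟩ ha
  have hf0 : f 0 = 2 * gaussInt t := by
    simp [hf]; norm_num
  rw [hf0] at hfin
  simp only [upperTail]
  rw [intervalIntegral.integral_div, intervalIntegral.integral_sub (by simp)
    (((hFc a).intervalIntegrable _ _).const_mul _), intervalIntegral.integral_const_mul]
  have hmul := mul_le_mul_of_nonneg_left hfin gaussScale_pos.le
  simp only [intervalIntegral.integral_const, smul_eq_mul]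
  change 2 * gaussInt t ≤ ∫ u in (-1 : ℝ)..1, _ at hfin
  change gaussScale * (2 * gaussInt t) ≤ gaussScale * ∫ u in (-1 : ℝ)..1, _ at hmul
  linarith

/-! ### Tail bounds for thresholds up to `1.05` -/

/-- If the tail exceeded `b`, the mass `q` below `t * ρ` would be smaller than `1 - b`. In the
uniform case of `tail_secondMoment_relation` this contradicts `1 - b ≤ t`. In the exponential case
it makes the logarithm strictly closer to zero than the one in `hlog`, again a contradiction. -/
theorem tail_le_of_sq_log_mix_le {g : ℝ → ℝ} (nonneg : ∀ x, 0 ≤ x → 0 ≤ g x)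
    (anti : AntitoneOn g (Set.Ici 0))
    (mid : ∀ x y, 0 ≤ x → x ≤ y → g x * g y ≤ g ((x + y) / 2) ^ 2)
    {ρ R t b : ℝ} (hρ : 0 < ρ) (ht : 0 < t) (htR : t * ρ < R) (h1 : ∫ x in (0 : ℝ)..R, g x = 1)
    (hM : ∫ x in (0 : ℝ)..R, x ^ 2 * g x = ρ ^ 2 / 3) (hb : 0 < b) (hbt : 1 - b ≤ t)
    (hlog : ∀ β, 0 < β → Real.log (b + (1 - b) * Real.exp (-β)) ^ 2 ≤
      t ^ 2 * (6 - 3 * (β ^ 2 + 2 * β) / (Real.exp β - 1))) :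
    ∫ x in (t * ρ)..R, g x ≤ b := by
  by_contra hcon
  push Not at hcon
  have ht0 : 0 < t * ρ := by positivity
  have hint : ∀ u v, 0 ≤ u → 0 ≤ v → IntervalIntegrable g volume u v := by
    intro u v hu hv
    exact AntitoneOn.intervalIntegrable (anti.mono fun x hx => (le_min hu hv).trans hx.1)
  set q := ∫ x in (0 : ℝ)..(t * ρ), g x with hq
  have hq0 : 0 ≤ q := intervalIntegral.integral_nonneg ht0.le fun x hx => nonneg x hx.1
  have hp : ∫ x in (t * ρ)..R, g x = 1 - q := by
    rw [← h1, ← intervalIntegral.integral_add_adjacent_intervals (hint 0 (t * ρ) le_rfl ht0.le)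
      (hint (t * ρ) R ht0.le (ht0.trans htR).le)]
    ring
  rw [hp] at hcon
  have hρ2 : 0 < ρ ^ 2 := by positivity
  rcases tail_secondMoment_relation nonneg anti mid ht0 htR hq.symm hp (by linarith) hM with
    h | ⟨β, hβ, h⟩
  · have h2 : t ^ 2 ≤ q ^ 2 := by
      rw [mul_pow] at h
      by_contra hc
      push Not at hc
      nlinarith
    have := (pow_le_pow_iff_left₀ ht.le hq0 two_ne_zero).1 h2
    linarith
  · have he : Real.exp (-β) < 1 := by rw [Real.exp_lt_one_iff]; linarith
    have he0 := Real.exp_pos (-β)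
    have h3 : t ^ 2 * (6 - 3 * (β ^ 2 + 2 * β) / (Real.exp β - 1)) ≤
        Real.log (1 - q + q * Real.exp (-β)) ^ 2 := by
      by_contra hc
      push Not at hc
      rw [mul_pow] at h
      nlinarith
    have hlt : b + (1 - b) * Real.exp (-β) < 1 - q + q * Real.exp (-β) := by nlinarith
    have hpos : 0 < b + (1 - b) * Real.exp (-β) := by nlinarith
    have hl1 := Real.log_lt_log hpos hlt
    have hl2 : Real.log (1 - q + q * Real.exp (-β)) ≤ 0 :=
      Real.log_nonpos (hpos.trans hlt).le (by nlinarith)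
    have := hlog β hβ
    nlinarith

/-- Gauss' inequality for decreasing densities. -/
theorem gauss_inequality {g : ℝ → ℝ} (nonneg : ∀ x, 0 ≤ x → 0 ≤ g x)
    (anti : AntitoneOn g (Set.Ici 0)) {x R M : ℝ} (hx : 0 < x) (hR : 3 / 2 * x ≤ R)
    (hM : ∫ z in (0 : ℝ)..R, z ^ 2 * g z = M) :
    ∫ z in x..R, g z ≤ 4 / (9 * x ^ 2) * M := by
  have hint : ∀ u v, 0 ≤ u → 0 ≤ v → IntervalIntegrable g volume u v := by
    intro u v hu hv
    exact AntitoneOn.intervalIntegrable (anti.mono fun x hx => (le_min hu hv).trans hx.1)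
  -- The proof compares `g` with `k * z² * g`, where `k * z² = 1` exactly at `z = w`. The choice of
  -- `w` balances the integral of `1 - k * z²` over `[x, w]` against that of `k * z²` over `[0, x]`,
  -- which is `e3`.
  set w := 3 / 2 * x with hw
  set k := 4 / (9 * x ^ 2) with hk
  have hk0 : 0 < k := by positivity
  have hxw : x ≤ w := by linarith
  have hkw : k * w ^ 2 = 1 := by rw [hk, hw]; field_simp; norm_num
  have hw0 : 0 ≤ w := by linarith
  have hR0 : 0 ≤ R := by linarith
  have hkint : ∀ u v, 0 ≤ u → 0 ≤ v → IntervalIntegrable (fun z => k * (z ^ 2 * g z)) volume u v :=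
    fun u v hu hv => ((hint u v hu hv).continuousOn_mul (by fun_prop)).const_mul k
  have h1 : ∫ z in (0 : ℝ)..x, k * (z ^ 2 * g x) ≤ ∫ z in (0 : ℝ)..x, k * (z ^ 2 * g z) := by
    apply intervalIntegral.integral_mono_on hx.le
      (Continuous.intervalIntegrable (by fun_prop) _ _) (hkint _ _ le_rfl hx.le)
    intro z hz
    have := anti hz.1 hx.le hz.2
    gcongr
  have h2 : ∫ z in x..w, (g z - k * (z ^ 2 * g z)) ≤ ∫ z in x..w, (1 - k * z ^ 2) * g x := by
    apply intervalIntegral.integral_mono_on hxw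
      ((hint _ _ hx.le hw0).sub (hkint _ _ hx.le hw0))
      (Continuous.intervalIntegrable (by fun_prop) _ _)
    intro z hz
    have h3 := anti hx.le (hx.le.trans hz.1) hz.1
    have h4 : 0 ≤ 1 - k * z ^ 2 := by
      have : z ^ 2 ≤ w ^ 2 := pow_le_pow_left₀ (hx.le.trans hz.1) hz.2 2
      nlinarith
    nlinarith
  have h5 : ∫ z in w..R, g z ≤ ∫ z in w..R, k * (z ^ 2 * g z) := by
    apply intervalIntegral.integral_mono_on hR (hint _ _ hw0 hR0) (hkint _ _ hw0 hR0)
    intro z hz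
    have h3 := nonneg z (hw0.trans hz.1)
    have h4 : 1 ≤ k * z ^ 2 := by
      rw [← hkw]
      exact mul_le_mul_of_nonneg_left (pow_le_pow_left₀ hw0 hz.1 2) hk0.le
    nlinarith
  have e1 : ∫ z in (0 : ℝ)..x, k * (z ^ 2 * g x) = k * (x ^ 3 / 3 * g x) := by
    rw [intervalIntegral.integral_const_mul, intervalIntegral.integral_mul_const, integral_pow]
    norm_num
  have e2 : ∫ z in x..w, (1 - k * z ^ 2) * g x = (w - x - k * (w ^ 3 - x ^ 3) / 3) * g x := by
    rw [intervalIntegral.integral_mul_const, intervalIntegral.integral_sub (by simp)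
      (Continuous.intervalIntegrable (by fun_prop) _ _), intervalIntegral.integral_const_mul,
      integral_pow]
    simp
    ring_nf
    simp
  have e3 : w - x - k * (w ^ 3 - x ^ 3) / 3 = k * (x ^ 3 / 3) := by
    have : k * w ^ 3 = w := by rw [show w ^ 3 = w ^ 2 * w by ring, ← mul_assoc, hkw, one_mul]
    linarith
  rw [intervalIntegral.integral_sub (hint _ _ hx.le hw0) (hkint _ _ hx.le hw0)] at h2
  have a1 := intervalIntegral.integral_add_adjacent_intervals (hkint 0 x le_rfl hx.le)
    (hkint x R hx.le hR0)
  have a2 := intervalIntegral.integral_add_adjacent_intervals (hkint x w hx.le hw0)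
    (hkint w R hw0 hR0)
  have a3 := intervalIntegral.integral_add_adjacent_intervals (hint x w hx.le hw0)
    (hint w R hw0 hR0)
  rw [intervalIntegral.integral_const_mul (a := 0) (b := R), hM] at a1
  rw [e1] at h1
  rw [e2, e3] at h2
  nlinarith

/-- The tail integral of a decreasing density is convex. -/
theorem tail_le_chord {g : ℝ → ℝ} (anti : AntitoneOn g (Set.Ici 0)) {x₁ x x₂ R b₁ b₂ : ℝ}
    (h0 : 0 ≤ x₁) (h1 : x₁ ≤ x) (h2 : x ≤ x₂) (h12 : x₁ < x₂) (hR : 0 ≤ R)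
    (hb₁ : ∫ z in x₁..R, g z ≤ b₁) (hb₂ : ∫ z in x₂..R, g z ≤ b₂) :
    ∫ z in x..R, g z ≤ ((x₂ - x) * b₁ + (x - x₁) * b₂) / (x₂ - x₁) := by
  have hint : ∀ u v, 0 ≤ u → 0 ≤ v → IntervalIntegrable g volume u v := by
    intro u v hu hv
    exact AntitoneOn.intervalIntegrable (anti.mono fun x hx => (le_min hu hv).trans hx.1)
  have hx : 0 ≤ x := h0.trans h1
  have hx2 : 0 ≤ x₂ := hx.trans h2
  have a1 := intervalIntegral.integral_add_adjacent_intervals (hint x₁ x h0 hx) (hint x R hx hR)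
  have a2 := intervalIntegral.integral_add_adjacent_intervals (hint x x₂ hx hx2) (hint x₂ R hx2 hR)
  have b1 : ∫ z in x₁..x, g x ≤ ∫ z in x₁..x, g z :=
    intervalIntegral.integral_mono_on h1 (by simp) (hint _ _ h0 hx)
      fun z hz => anti (h0.trans hz.1) hx hz.2
  have b2 : ∫ z in x..x₂, g z ≤ ∫ z in x..x₂, g x :=
    intervalIntegral.integral_mono_on h2 (hint _ _ hx hx2) (by simp)
      fun z hz => anti hx (hx.trans hz.1) hz.1
  simp only [intervalIntegral.integral_const, smul_eq_mul] at b1 b2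
  rw [le_div_iff₀ (by linarith)]
  have c1 : (∫ z in x..R, g z) ≤ b₁ - (x - x₁) * g x := by linarith
  have c2 : (∫ z in x..R, g z) ≤ b₂ + (x₂ - x) * g x := by linarith
  nlinarith [mul_le_mul_of_nonneg_left c1 (sub_nonneg.2 h2),
    mul_le_mul_of_nonneg_left c2 (sub_nonneg.2 h1)]

theorem cStar_pos : 0 < cStar := by have := le_cStar; linarith

/-- A point below a tangent line of `1.345118 · P(|G| > t√3)`, recorded through a rational
upper estimate `e` for the value of the tangent to `gaussInt`. -/
theorem le_tangent_of_bound {m s b e : ℝ}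
    (he : gaussInt m + Real.exp (-(3 / 2 * m ^ 2)) * (s - m) ≤ e)
    (hb : b ≤ 1.345118 * (1 - 1.38197659789 * e)) (he0 : 0 ≤ e) :
    b ≤ 1.345118 * (1 - gaussScale *
      (gaussInt m + Real.exp (-(3 / 2 * m ^ 2)) * (s - m))) := by
  have h1 := mul_le_mul_of_nonneg_left he gaussScale_pos.le
  have h2 := mul_le_mul_of_nonneg_right gaussScale_lt.le he0
  linarith

/-- The Gaussian tail is convex on the half-line, so it lies above its tangent at `m`; chord and
tangent are both affine and need comparing only at the two ends. Nonnegativity of `b₁`, `b₂` makes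
the tangent values nonnegative, so that `1.345118` may be replaced by `cStar`. -/
theorem chord_le_cStar_mul {m s₁ s₂ t b₁ b₂ : ℝ} (hm : 0 ≤ m) (ht : 0 ≤ t) (h1 : s₁ ≤ t)
    (h2 : t ≤ s₂) (h12 : s₁ < s₂) (hb₁ : 0 ≤ b₁) (hb₂ : 0 ≤ b₂)
    (hl₁ : b₁ ≤ 1.345118 * (1 - gaussScale *
      (gaussInt m + Real.exp (-(3 / 2 * m ^ 2)) * (s₁ - m))))
    (hl₂ : b₂ ≤ 1.345118 * (1 - gaussScale *
      (gaussInt m + Real.exp (-(3 / 2 * m ^ 2)) * (s₂ - m)))) :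
    ((s₂ - t) * b₁ + (t - s₁) * b₂) / (s₂ - s₁) ≤ cStar * (1 - gaussScale * gaussInt t) := by
  have hE := mul_le_mul_of_nonneg_left (gaussInt_le_tangent hm ht) gaussScale_pos.le
  set A := gaussInt m
  set e := Real.exp (-(3 / 2 * m ^ 2))
  have hc := le_cStar
  set X₁ := 1 - gaussScale * (A + e * (s₁ - m)) with hX₁
  set X₂ := 1 - gaussScale * (A + e * (s₂ - m)) with hX₂
  have hX : (s₂ - s₁) * (1 - gaussScale * (A + e * (t - m))) = (s₂ - t) * X₁ + (t - s₁) * X₂ := by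
    rw [hX₁, hX₂]; ring
  have c1 : b₁ ≤ cStar * X₁ := by nlinarith
  have c2 : b₂ ≤ cStar * X₂ := by nlinarith
  rw [div_le_iff₀ (by linarith)]
  have d1 := mul_le_mul_of_nonneg_left c1 (sub_nonneg.2 h2)
  have d2 := mul_le_mul_of_nonneg_left c2 (sub_nonneg.2 h1)
  have d3 : (s₂ - s₁) * (1 - gaussScale * (A + e * (t - m))) ≤
      (s₂ - s₁) * (1 - gaussScale * gaussInt t) :=
    mul_le_mul_of_nonneg_left (by linarith) (by linarith)
  have d4 := mul_le_mul_of_nonneg_left d3 cStar_pos.le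
  rw [hX] at d4
  nlinarith

/-- The tail comparison on `(0, 1.05]` for decreasing log-concave densities on the half-line. -/
theorem tail_le_of_logConcave {g : ℝ → ℝ} (nonneg : ∀ x, 0 ≤ x → 0 ≤ g x)
    (anti : AntitoneOn g (Set.Ici 0))
    (mid : ∀ x y, 0 ≤ x → x ≤ y → g x * g y ≤ g ((x + y) / 2) ^ 2)
    {ρ R t : ℝ} (hρ : 0 < ρ) (hR : 1.05 * ρ < R) (h1 : ∫ x in (0 : ℝ)..R, g x = 1)
    (hM : ∫ x in (0 : ℝ)..R, x ^ 2 * g x = ρ ^ 2 / 3) (ht : 0 < t) (ht1 : t ≤ 1.05) :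
    ∫ x in (t * ρ)..R, g x ≤ cStar * (1 - gaussScale * gaussInt t) := by
  have hR0 : 0 ≤ R := by nlinarith
  have p1 : ∫ x in (2 / 3 * ρ)..R, g x ≤ 1 / 3 := by
    have := gauss_inequality nonneg anti (x := 2 / 3 * ρ) (by positivity) (by linarith) hM
    convert this using 1
    field_simp; norm_num
  have p2 : ∫ x in (0.7 * ρ)..R, g x ≤ 0.30235 := by
    have := gauss_inequality nonneg anti (x := 0.7 * ρ) (by positivity) (by linarith) hM
    refine this.trans ?_
    rw [show 4 / (9 * (0.7 * ρ) ^ 2) * (ρ ^ 2 / 3) = 4 / (27 * 0.49) by field_simp; norm_num]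
    norm_num
  have p3 : ∫ x in (0.8 * ρ)..R, g x ≤ 0.217 :=
    tail_le_of_sq_log_mix_le nonneg anti mid hρ (by norm_num) (by linarith) h1 hM
      (by norm_num) (by norm_num) fun β hβ => sq_log_mix_le_four_fifths hβ
  have p4 : ∫ x in (0.95 * ρ)..R, g x ≤ 0.1295 :=
    tail_le_of_sq_log_mix_le nonneg anti mid hρ (by norm_num) (by linarith) h1 hM
      (by norm_num) (by norm_num) fun β hβ => sq_log_mix_le_nineteen_twentieths hβ
  have p5 : ∫ x in (1.05 * ρ)..R, g x ≤ 0.0922 :=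
    tail_le_of_sq_log_mix_le nonneg anti mid hρ (by norm_num) (by linarith) h1 hM
      (by norm_num) (by norm_num) fun β hβ => sq_log_mix_le_twentyone_twentieths hβ
  have chord : ∀ s₁ s₂ b₁ b₂ : ℝ, 0 ≤ s₁ → s₁ ≤ t → t ≤ s₂ → s₁ < s₂ →
      ∫ x in (s₁ * ρ)..R, g x ≤ b₁ → ∫ x in (s₂ * ρ)..R, g x ≤ b₂ →
      ∫ x in (t * ρ)..R, g x ≤ ((s₂ - t) * b₁ + (t - s₁) * b₂) / (s₂ - s₁) := by
    intro s₁ s₂ b₁ b₂ h0 h2 h3 h4 hb₁ hb₂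
    have := tail_le_chord anti (x₁ := s₁ * ρ) (x := t * ρ) (x₂ := s₂ * ρ) (by positivity)
      (by gcongr) (by gcongr) (by gcongr) hR0 hb₁ hb₂
    convert this using 1
    field_simp
  -- The chord from `(0, 1)` to `(2/3, 1/3)` is `1 - t`, so the definition of `cStar` applies
  -- directly. The later intervals use tangents at the points `m` and rational bounds `e` for their
  -- values.
  rcases le_total t (2 / 3) with h | h
  · have := chord 0 (2 / 3) 1 (1 / 3) le_rfl ht.le h (by norm_num) (by rw [zero_mul, h1]) p1
    refine this.trans ?_
    refine le_trans (le_of_eq ?_) (one_sub_le_cStar_mul ⟨ht, by linarith⟩)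
    ring
  rcases le_total t 0.7 with h' | h'
  · refine (chord _ _ _ _ (by norm_num) h h' (by norm_num) p1 p2).trans
      (chord_le_cStar_mul (m := 0.68) (by norm_num) ht.le h h' (by norm_num) (by norm_num)
        (by norm_num) ?_ ?_)
    all_goals
      have h1 := gaussInt_le 6 (t := 0.68) (by norm_num)
      have h2 := sum_le_exp_of_even 6 (-(3 / 2 * 0.68 ^ 2))
      have h3 := exp_le_sum_of_odd 6 (x := -(3 / 2 * 0.68 ^ 2)) (by norm_num)
      norm_num [Finset.sum_range_succ, Nat.factorial] at h1 h2 h3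
    · exact le_tangent_of_bound (e := 0.54415) (by norm_num; linarith) (by norm_num) (by norm_num)
    · exact le_tangent_of_bound (e := 0.56085) (by norm_num; linarith) (by norm_num) (by norm_num)
  clear h
  rcases le_total t 0.8 with h | h
  · refine (chord _ _ _ _ (by norm_num) h' h (by norm_num) p2 p3).trans
      (chord_le_cStar_mul (m := 0.72) (by norm_num) ht.le h' h (by norm_num) (by norm_num)
        (by norm_num) ?_ ?_)
    all_goals
      have h1 := gaussInt_le 6 (t := 0.72) (by norm_num)
      have h2 := sum_le_exp_of_even 6 (-(3 / 2 * 0.72 ^ 2))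
      have h3 := exp_le_sum_of_odd 6 (x := -(3 / 2 * 0.72 ^ 2)) (by norm_num)
      norm_num [Finset.sum_range_succ, Nat.factorial] at h1 h2 h3
    · exact le_tangent_of_bound (e := 0.56085) (by norm_num; linarith) (by norm_num) (by norm_num)
    · exact le_tangent_of_bound (e := 0.60675) (by norm_num; linarith) (by norm_num) (by norm_num)
  clear h'
  rcases le_total t 0.95 with h' | h'
  · refine (chord _ _ _ _ (by norm_num) h h' (by norm_num) p3 p4).trans
      (chord_le_cStar_mul (m := 0.87) (by norm_num) ht.le h h' (by norm_num) (by norm_num)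
        (by norm_num) ?_ ?_)
    all_goals
      have h1 := gaussInt_le 7 (t := 0.87) (by norm_num)
      have h2 := sum_le_exp_of_even 7 (-(3 / 2 * 0.87 ^ 2))
      have h3 := exp_le_sum_of_odd 7 (x := -(3 / 2 * 0.87 ^ 2)) (by norm_num)
      norm_num [Finset.sum_range_succ, Nat.factorial] at h1 h2 h3
    · exact le_tangent_of_bound (e := 0.6062) (by norm_num; linarith) (by norm_num) (by norm_num)
    · exact le_tangent_of_bound (e := 0.65392) (by norm_num; linarith) (by norm_num) (by norm_num)
  · refine (chord _ _ _ _ (by norm_num) h' ht1 (by norm_num) p4 p5).trans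
      (chord_le_cStar_mul (m := 1.02) (by norm_num) ht.le h' ht1 (by norm_num) (by norm_num)
        (by norm_num) ?_ ?_)
    all_goals
      have h1 := gaussInt_le 8 (t := 1.02) (by norm_num)
      have h2 := sum_le_exp_of_even 8 (-(3 / 2 * 1.02 ^ 2))
      have h3 := exp_le_sum_of_odd 8 (x := -(3 / 2 * 1.02 ^ 2)) (by norm_num)
      norm_num [Finset.sum_range_succ, Nat.factorial] at h1 h2 h3
    · exact le_tangent_of_bound (e := 0.6533) (by norm_num; linarith) (by norm_num) (by norm_num)
    · exact le_tangent_of_bound (e := 0.67399) (by norm_num; linarith) (by norm_num) (by norm_num)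

/-! ### Convolution of even log-concave densities -/

/-- Bounded, compactly supported, even, log-concave probability densities on `ℝ` with second
moment `M`. -/
structure IsLogConcaveDensity (f : ℝ → ℝ) (M : ℝ) : Prop where
  measurable : Measurable f
  nonneg : ∀ x, 0 ≤ f x
  even : ∀ x, f (-x) = f x
  bounded : ∃ K, ∀ x, f x ≤ K
  support : ∃ R, 0 < R ∧ ∀ x, R < |x| → f x = 0
  logConcave : ∀ lo m₁ m₂ hi, lo ≤ m₁ → lo ≤ m₂ → m₁ + m₂ = lo + hi → f lo * f hi ≤ f m₁ * f m₂
  mass : ∫ x, f x = 1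
  moment : ∫ x, x ^ 2 * f x = M

theorem integrable_of_bounded_support {h : ℝ → ℝ} (hm : Measurable h) {B R : ℝ}
    (hB : ∀ x, |h x| ≤ B) (hR : ∀ x, R < |x| → h x = 0) : Integrable h := by
  have hon : IntegrableOn h (Set.Icc (-R) R) :=
    Measure.integrableOn_of_bounded (by simp) hm.aestronglyMeasurable
      (Filter.Eventually.of_forall hB)
  refine (integrableOn_iff_integrable_of_support_subset ?_).1 hon
  intro x hx
  by_contra hc
  apply hx
  apply hR
  rw [Set.mem_Icc, ← abs_le] at hc
  exact not_le.1 hc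

theorem integrable_prod_of_bounded_support {h : ℝ × ℝ → ℝ} (hm : Measurable h) {B R : ℝ}
    (hB : ∀ x, |h x| ≤ B) (hR : ∀ x, R < |x.1| ∨ R < |x.2| → h x = 0) :
    Integrable h (volume.prod volume) := by
  have hon : IntegrableOn h (Set.Icc (-R) R ×ˢ Set.Icc (-R) R) (volume.prod volume) :=
    Measure.integrableOn_of_bounded
      (by rw [Measure.prod_prod]; simp [ENNReal.mul_eq_top]) hm.aestronglyMeasurable
      (Filter.Eventually.of_forall hB)
  refine (integrableOn_iff_integrable_of_support_subset ?_).1 hon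
  intro x hx
  by_contra hc
  apply hx
  apply hR
  by_contra h2
  push Not at h2
  exact hc ⟨abs_le.1 h2.1, abs_le.1 h2.2⟩

namespace IsLogConcaveDensity

variable {f k : ℝ → ℝ} {M N : ℝ}

theorem abs_le (hf : IsLogConcaveDensity f M) : ∃ K, 0 ≤ K ∧ ∀ x, |f x| ≤ K := by
  obtain ⟨K, hK⟩ := hf.bounded
  exact ⟨K, (hf.nonneg 0).trans (hK 0), fun x => by rw [abs_of_nonneg (hf.nonneg x)]; exact hK x⟩

theorem integrable_mul (hf : IsLogConcaveDensity f M) {φ : ℝ → ℝ} (hφ : Measurable φ)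
    (hb : ∀ r, ∃ B, ∀ z, |z| ≤ r → |φ z| ≤ B) : Integrable fun x => φ x * f x := by
  obtain ⟨K, hK0, hK⟩ := hf.abs_le
  obtain ⟨R, hR0, hR⟩ := hf.support
  obtain ⟨B, hB⟩ := hb R
  have hB0 : 0 ≤ B := (abs_nonneg _).trans (hB 0 (by simpa using hR0.le))
  apply integrable_of_bounded_support (B := B * K) (R := R) (hφ.mul hf.measurable)
  · intro x
    rw [Pi.mul_apply]
    rcases le_or_gt |x| R with h | h
    · rw [abs_mul]
      exact mul_le_mul (hB x h) (hK x) (abs_nonneg _) hB0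
    · rw [hR x h]; simp; positivity
  · intro x hx
    rw [Pi.mul_apply, hR x hx, mul_zero]

theorem integrable (hf : IsLogConcaveDensity f M) : Integrable f := by
  simpa using hf.integrable_mul (φ := fun _ => 1) measurable_const (fun _ => ⟨1, by simp⟩)

theorem integrable_sq (hf : IsLogConcaveDensity f M) : Integrable fun x => x ^ 2 * f x :=
  hf.integrable_mul (φ := fun x => x ^ 2) (by fun_prop) (fun r => ⟨r ^ 2, fun z hz => by
    rw [abs_pow]; exact pow_le_pow_left₀ (abs_nonneg _) hz 2⟩)

theorem integrable_id_mul (hf : IsLogConcaveDensity f M) : Integrable fun x => x * f x :=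
  hf.integrable_mul (φ := fun x => x) measurable_id (fun r => ⟨r, fun _ hz => hz⟩)

theorem mean (hf : IsLogConcaveDensity f M) : ∫ x, x * f x = 0 := by
  have := integral_neg_eq_self (fun x => x * f x) volume
  simp only [hf.even, neg_mul, integral_neg] at this
  linarith

/-- Fubini against a locally bounded test function. The choices `1`, `z²` and the indicator of a
half-line yield the mass, the second moment and the tail of the convolution. -/
theorem integral_mul_convolution (hf : IsLogConcaveDensity f M) (hk : IsLogConcaveDensity k N)
    {φ : ℝ → ℝ} (hφ : Measurable φ) (hb : ∀ r, ∃ B, ∀ z, |z| ≤ r → |φ z| ≤ B) :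
    ∫ z, φ z * ∫ y, k y * f (z - y) = ∫ y, k y * ∫ s, f s * φ (s + y) := by
  obtain ⟨K, hK0, hK⟩ := hf.abs_le
  obtain ⟨L, hL0, hL⟩ := hk.abs_le
  obtain ⟨R, hR0, hR⟩ := hf.support
  obtain ⟨S, hS0, hS⟩ := hk.support
  obtain ⟨B, hB⟩ := hb (R + S)
  have hB0 : 0 ≤ B := (abs_nonneg _).trans (hB 0 (by simp; positivity))
  have hzero : ∀ z y, R + S < |z| → k y * f (z - y) = 0 := by
    intro z y h
    rcases le_or_gt |y| S with h1 | h1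
    · rw [hR (z - y), mul_zero]
      have := abs_sub_abs_le_abs_sub z y
      linarith
    · rw [hS y h1, zero_mul]
  have hint : Integrable (Function.uncurry fun z y => φ z * (k y * f (z - y)))
      (volume.prod volume) := by
    apply integrable_prod_of_bounded_support (B := B * (L * K)) (R := R + S)
    · exact (hφ.comp measurable_fst).mul ((hk.measurable.comp measurable_snd).mul
        (hf.measurable.comp (measurable_fst.sub measurable_snd)))
    · rintro ⟨z, y⟩
      simp only [Function.uncurry]
      rcases le_or_gt |z| (R + S) with h | h
      · rw [abs_mul, abs_mul]
        exact mul_le_mul (hB z h) (mul_le_mul (hL y) (hK _) (abs_nonneg _) hL0)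
          (by positivity) hB0
      · rw [hzero z y h]; simp; positivity
    · rintro ⟨z, y⟩ h
      simp only [Function.uncurry]
      rcases h with h | h
      · rw [hzero z y h, mul_zero]
      · rw [hS y (by simp only at h; linarith)]; simp
  calc ∫ z, φ z * ∫ y, k y * f (z - y) = ∫ z, ∫ y, φ z * (k y * f (z - y)) := by
        simp only [integral_const_mul]
    _ = ∫ y, ∫ z, φ z * (k y * f (z - y)) := integral_integral_swap hint
    _ = ∫ y, k y * ∫ s, f s * φ (s + y) := by
        congr 1; ext y
        rw [← integral_const_mul,
          ← integral_sub_right_eq_self (fun s => k y * (f s * φ (s + y))) y]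
        congr 1; ext z
        simp only [sub_add_cancel]; ring

/-- A Cauchy–Binet argument. Shifting the integration variable makes the difference of the two sides
a double integral of some `F`, and `F` plus its swap is a product of two `2 × 2` minors, one of `k`
and one of `f`. The four-point form of log-concavity gives both minors the same sign. -/
theorem convolution_logConcave (hf : IsLogConcaveDensity f M) (hk : IsLogConcaveDensity k N)
    {lo m₁ m₂ hi : ℝ} (h₁ : lo ≤ m₁) (h₂ : lo ≤ m₂) (h : m₁ + m₂ = lo + hi) :
    (∫ y, k y * f (lo - y)) * (∫ y, k y * f (hi - y)) ≤
      (∫ y, k y * f (m₁ - y)) * ∫ y, k y * f (m₂ - y) := by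
  obtain ⟨L, hL0, hL⟩ := hk.abs_le
  set d := m₁ - lo with hd
  have hsub : ∀ x e, ∫ y, k y * f (x - e - y) = ∫ z, k (x - z) * f (z - e) := by
    intro x e
    rw [← integral_sub_left_eq_self _ volume x]
    congr 1; ext z
    congr 2; ring
  have hint : ∀ x e, Integrable fun z => k (x - z) * f (z - e) := by
    intro x e
    apply (hf.integrable.comp_sub_right e).bdd_mul
      (hk.measurable.comp (measurable_const.sub measurable_id)).aestronglyMeasurable
      (c := L) (Filter.Eventually.of_forall fun z => hL _)
  have e1 : ∫ y, k y * f (lo - y) = ∫ z, k (m₁ - z) * f (z - d) := by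
    rw [← hsub]; simp [hd]
  have e2 : ∫ y, k y * f (hi - y) = ∫ z, k (hi - z) * f (z - 0) := by
    rw [← hsub]; simp
  have e3 : ∫ y, k y * f (m₁ - y) = ∫ z, k (m₁ - z) * f (z - 0) := by
    rw [← hsub]; simp
  have e4 : ∫ y, k y * f (m₂ - y) = ∫ z, k (hi - z) * f (z - d) := by
    rw [← hsub, show hi - d = m₂ by rw [hd]; linarith]
  rw [e1, e2, e3, e4, ← integral_prod_mul, ← integral_prod_mul, ← sub_nonneg,
    ← integral_sub ((hint _ _).mul_prod (hint _ _)) ((hint _ _).mul_prod (hint _ _))]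
  set F : ℝ × ℝ → ℝ := fun z =>
    k (m₁ - z.1) * f (z.1 - 0) * (k (hi - z.2) * f (z.2 - d)) -
    k (m₁ - z.1) * f (z.1 - d) * (k (hi - z.2) * f (z.2 - 0)) with hF
  have hFint : Integrable F (volume.prod volume) :=
    ((hint _ _).mul_prod (hint _ _)).sub ((hint _ _).mul_prod (hint _ _))
  change 0 ≤ ∫ z, F z ∂(volume.prod volume)
  have hswap : ∫ z, F z.swap ∂(volume.prod volume) = ∫ z, F z ∂(volume.prod volume) :=
    integral_prod_swap F
  have hsum : 0 ≤ ∫ z, (F z + F z.swap) ∂(volume.prod volume) := by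
    apply integral_nonneg
    rintro ⟨z₁, z₂⟩
    have e : F (z₁, z₂) + F (z₁, z₂).swap =
        (k (m₁ - z₁) * k (hi - z₂) - k (m₁ - z₂) * k (hi - z₁)) *
        (f z₁ * f (z₂ - d) - f (z₁ - d) * f z₂) := by
      simp only [hF, Prod.swap, sub_zero]; ring
    change 0 ≤ F (z₁, z₂) + F (z₁, z₂).swap
    rw [e]
    have hd0 : 0 ≤ d := by linarith
    have hmh : m₁ ≤ hi := by linarith
    rcases le_total z₁ z₂ with hz | hz
    · apply mul_nonneg
      · have := hk.logConcave (m₁ - z₂) (m₁ - z₁) (hi - z₂) (hi - z₁) (by linarith) (by linarith)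
          (by ring)
        linarith
      · have := hf.logConcave (z₁ - d) z₁ (z₂ - d) z₂ (by linarith) (by linarith) (by ring)
        linarith
    · apply mul_nonneg_of_nonpos_of_nonpos
      · have := hk.logConcave (m₁ - z₁) (m₁ - z₂) (hi - z₁) (hi - z₂) (by linarith) (by linarith)
          (by ring)
        linarith
      · have := hf.logConcave (z₂ - d) z₂ (z₁ - d) z₁ (by linarith) (by linarith) (by ring)
        linarith
  have hadd : ∫ z, (F z + F z.swap) ∂(volume.prod volume) =
      (∫ z, F z ∂(volume.prod volume)) + ∫ z, F z.swap ∂(volume.prod volume) :=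
    integral_add hFint hFint.swap
  linarith

theorem convolution (hf : IsLogConcaveDensity f M) (hk : IsLogConcaveDensity k N) :
    IsLogConcaveDensity (fun z => ∫ y, k y * f (z - y)) (M + N) where
  measurable := by
    have : StronglyMeasurable (Function.uncurry fun z y => k y * f (z - y)) :=
      ((hk.measurable.comp measurable_snd).mul
        (hf.measurable.comp (measurable_fst.sub measurable_snd))).stronglyMeasurable
    exact this.integral_prod_right.measurable
  nonneg z := integral_nonneg fun y => mul_nonneg (hk.nonneg _) (hf.nonneg _)
  even z := by
    rw [← integral_neg_eq_self]
    congr 1; ext y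
    rw [hk.even, ← hf.even]
    congr 2; ring
  bounded := by
    obtain ⟨K, hK⟩ := hf.bounded
    obtain ⟨K', hK0', hK'⟩ := hf.abs_le
    refine ⟨K, fun z => ?_⟩
    calc ∫ y, k y * f (z - y) ≤ ∫ y, k y * K := by
          apply integral_mono _ (hk.integrable.mul_const K)
            fun y => mul_le_mul_of_nonneg_left (hK _) (hk.nonneg _)
          apply hk.integrable.mul_bdd
            (hf.measurable.comp (measurable_const.sub measurable_id)).aestronglyMeasurable
            (c := K') (Filter.Eventually.of_forall fun z => hK' _)
      _ = K := by rw [integral_mul_const, hk.mass, one_mul]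
  support := by
    obtain ⟨R, hR0, hR⟩ := hf.support
    obtain ⟨S, hS0, hS⟩ := hk.support
    refine ⟨R + S, by positivity, fun z hz => ?_⟩
    have : ∀ y, k y * f (z - y) = 0 := by
      intro y
      rcases le_or_gt |y| S with h1 | h1
      · rw [hR (z - y), mul_zero]
        have := abs_sub_abs_le_abs_sub z y
        linarith
      · rw [hS y h1, zero_mul]
    simp [this]
  logConcave lo m₁ m₂ hi h₁ h₂ h := hf.convolution_logConcave hk h₁ h₂ h
  mass := by
    have := hf.integral_mul_convolution hk (φ := fun _ => 1) measurable_const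
      (fun _ => ⟨1, by simp⟩)
    simpa [hf.mass, hk.mass] using this
  moment := by
    rw [hf.integral_mul_convolution hk (φ := fun z => z ^ 2) (by fun_prop) (fun r => ⟨r ^ 2,
      fun z hz => by rw [abs_pow]; exact pow_le_pow_left₀ (abs_nonneg _) hz 2⟩)]
    have h1 : ∀ y, ∫ s, f s * (s + y) ^ 2 = M + y ^ 2 := by
      intro y
      have e : (fun s => f s * (s + y) ^ 2) =
          fun s => s ^ 2 * f s + (2 * y) * (s * f s) + y ^ 2 * f s := by ext s; ring
      have i1 : Integrable fun s => s ^ 2 * f s + (2 * y) * (s * f s) :=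
        hf.integrable_sq.add (hf.integrable_id_mul.const_mul _)
      rw [e, integral_add i1 (hf.integrable.const_mul _),
        integral_add hf.integrable_sq (hf.integrable_id_mul.const_mul _), integral_const_mul,
        integral_const_mul, hf.moment, hf.mean, hf.mass]
      ring
    simp only [h1]
    have e : (fun y => k y * (M + y ^ 2)) = fun y => M * k y + y ^ 2 * k y := by ext y; ring
    rw [e, integral_add (hk.integrable.const_mul _) hk.integrable_sq, integral_const_mul, hk.mass,
      hk.moment, mul_one]

theorem integral_Ioi_convolution (hf : IsLogConcaveDensity f M) (hk : IsLogConcaveDensity k N)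
    (x : ℝ) : ∫ z in Set.Ioi x, ∫ y, k y * f (z - y) =
      ∫ y, k y * ∫ s in Set.Ioi (x - y), f s := by
  have h1 := hf.integral_mul_convolution hk (φ := (Set.Ioi x).indicator 1)
    (measurable_one.indicator measurableSet_Ioi) (fun _ => ⟨1, fun z _ => by
      by_cases h : z ∈ Set.Ioi x <;> simp [h]⟩)
  have e1 : ∀ z, (Set.Ioi x).indicator (1 : ℝ → ℝ) z * ∫ y, k y * f (z - y) =
      (Set.Ioi x).indicator (fun z => ∫ y, k y * f (z - y)) z := by
    intro z
    by_cases h : z ∈ Set.Ioi x <;> simp [h]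
  have e2 : ∀ y s, f s * (Set.Ioi x).indicator (1 : ℝ → ℝ) (s + y) =
      (Set.Ioi (x - y)).indicator f s := by
    intro y s
    by_cases h : x < s + y
    · simp [h, sub_lt_iff_lt_add]
    · simp [h, sub_lt_iff_lt_add]
  simp only [e1, e2] at h1
  rw [integral_indicator measurableSet_Ioi] at h1
  simp only [integral_indicator measurableSet_Ioi] at h1
  exact h1

/-- For `0 ≤ x ≤ y`, log-concavity at `-y, x, -x, y` together with evenness gives `f y ^ 2 ≤ f x ^
2`. -/
theorem antitoneOn (hf : IsLogConcaveDensity f M) : AntitoneOn f (Set.Ici 0) := by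
  intro x hx y hy hxy
  have hx' : 0 ≤ x := hx
  have := hf.logConcave (-y) x (-x) y (by linarith) (by linarith) (by ring)
  rw [hf.even, hf.even] at this
  have h1 := hf.nonneg x
  have h2 := hf.nonneg y
  nlinarith

theorem midpoint (hf : IsLogConcaveDensity f M) (x y : ℝ) (h : x ≤ y) :
    f x * f y ≤ f ((x + y) / 2) ^ 2 := by
  have := hf.logConcave x ((x + y) / 2) ((x + y) / 2) y (by linarith) (by linarith) (by ring)
  rwa [← sq] at this

theorem integral_Ioi_eq_of_support {R x : ℝ} (hR : ∀ x, R < |x| → f x = 0)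
    (hx : x ≤ R) : ∫ z in Set.Ioi x, f z = ∫ z in x..R, f z := by
  rw [intervalIntegral.integral_of_le hx]
  apply setIntegral_eq_of_subset_of_forall_sdiff_eq_zero measurableSet_Ioi
    Set.Ioc_subset_Ioi_self
  intro z hz
  apply hR
  have : R < z := by
    by_contra hc
    exact hz.2 ⟨hz.1, not_lt.1 hc⟩
  exact this.trans_le (le_abs_self z)

theorem integral_even_mul (hf : IsLogConcaveDensity f M) {R : ℝ} (hR0 : 0 ≤ R)
    (hR : ∀ x, R < |x| → f x = 0) {φ : ℝ → ℝ} (hφ : ∀ x, φ (-x) = φ x)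
    (hint : Integrable fun x => φ x * f x) :
    ∫ x, φ x * f x = ∫ x in (0 : ℝ)..R, φ x * (2 * f x) := by
  have h1 : ∫ x, φ x * f x = ∫ x in (-R)..R, φ x * f x := by
    rw [intervalIntegral.integral_of_le (by linarith), ← integral_Icc_eq_integral_Ioc]
    symm
    apply setIntegral_eq_integral_of_forall_compl_eq_zero
    intro x hx
    rw [hR, mul_zero]
    rw [Set.mem_Icc, ← _root_.abs_le] at hx
    exact not_le.1 hx
  have h2 := intervalIntegral.integral_comp_neg (a := 0) (b := R) (fun x => φ x * f x)
  simp only [hφ, hf.even, neg_zero] at h2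
  rw [h1, ← intervalIntegral.integral_add_adjacent_intervals (b := 0)
    hint.intervalIntegrable hint.intervalIntegrable, ← h2, ← two_mul,
    ← intervalIntegral.integral_const_mul]
  congr 1; ext x; ring

end IsLogConcaveDensity

/-! ### Box densities and tails of sums of uniform variables -/

/-- The density of the uniform distribution on `[-a, a]`. -/
noncomputable def boxDensity (a : ℝ) : ℝ → ℝ := (Set.Icc (-a) a).indicator fun _ => (2 * a)⁻¹

theorem integral_boxDensity_mul {a : ℝ} (ha : 0 < a) (φ : ℝ → ℝ) :
    ∫ y, boxDensity a y * φ y = (1 / 2) * ∫ u in (-1 : ℝ)..1, φ (a * u) := by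
  have h1 : ∀ y, boxDensity a y * φ y =
      (Set.Icc (-a) a).indicator (fun y => (2 * a)⁻¹ * φ y) y := by
    intro y
    by_cases h : y ∈ Set.Icc (-a) a <;> simp [boxDensity, h]
  simp only [h1]
  rw [integral_indicator measurableSet_Icc, integral_const_mul, integral_Icc_eq_integral_Ioc,
    ← intervalIntegral.integral_of_le (by linarith),
    intervalIntegral.integral_comp_mul_left φ ha.ne']
  simp only [smul_eq_mul, mul_neg, mul_one]
  field_simp

theorem isLogConcaveDensity_boxDensity {a : ℝ} (ha : 0 < a) :
    IsLogConcaveDensity (boxDensity a) (a ^ 2 / 3) where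
  measurable := measurable_const.indicator measurableSet_Icc
  nonneg x := Set.indicator_nonneg (fun _ _ => by positivity) x
  even x := by
    have : -x ∈ Set.Icc (-a) a ↔ x ∈ Set.Icc (-a) a := by
      simp only [Set.mem_Icc]; constructor <;> rintro ⟨h1, h2⟩ <;> constructor <;> linarith
    by_cases h : x ∈ Set.Icc (-a) a
    · simp only [boxDensity, Set.indicator_of_mem h, Set.indicator_of_mem (this.2 h)]
    · simp only [boxDensity, Set.indicator_of_notMem h, Set.indicator_of_notMem (mt this.1 h)]
  bounded := ⟨(2 * a)⁻¹, fun x => Set.indicator_le_self' (fun _ _ => by positivity) x⟩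
  support := ⟨a, ha, fun x hx => Set.indicator_of_notMem (fun h => by
    rw [Set.mem_Icc, ← abs_le] at h; linarith) _⟩
  logConcave lo m₁ m₂ hi h₁ h₂ h := by
    have hn : ∀ x, 0 ≤ boxDensity a x := fun x =>
      Set.indicator_nonneg (fun _ _ => by positivity) x
    by_cases hl : lo ∈ Set.Icc (-a) a
    · by_cases hh : hi ∈ Set.Icc (-a) a
      · have k1 : m₁ ∈ Set.Icc (-a) a := ⟨by linarith [hl.1], by linarith [hh.2]⟩
        have k2 : m₂ ∈ Set.Icc (-a) a := ⟨by linarith [hl.1], by linarith [hh.2]⟩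
        simp only [boxDensity, Set.indicator_of_mem hl, Set.indicator_of_mem hh,
          Set.indicator_of_mem k1, Set.indicator_of_mem k2, le_refl]
      · rw [show boxDensity a hi = 0 from Set.indicator_of_notMem hh _, mul_zero]
        exact mul_nonneg (hn _) (hn _)
    · rw [show boxDensity a lo = 0 from Set.indicator_of_notMem hl _, zero_mul]
      exact mul_nonneg (hn _) (hn _)
  mass := by
    have := integral_boxDensity_mul ha fun _ => 1
    norm_num at this
    exact this
  moment := by
    have := integral_boxDensity_mul ha fun y => y ^ 2
    simp only [mul_comm _ (boxDensity a _)]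
    rw [this]
    simp only [mul_pow, intervalIntegral.integral_const_mul, integral_pow]
    norm_num; ring

/-- After substitution the integral runs over `[d - b, d + b]`; its lower end is lowered to include
every point where the integrand is positive below `d + b`. This is the induction step for
`le_pow_div`. -/
theorem integral_posPart_pow_le {b d : ℝ} (hb : 0 < b) {n : ℕ} (hn : n ≠ 0) :
    (1 / 2) * ∫ u in (-1 : ℝ)..1, max (d + b * u) 0 ^ n ≤
      max (d + b) 0 ^ (n + 1) / (2 * b * (n + 1)) := by
  have hi : ∀ p q : ℝ, IntervalIntegrable (fun v : ℝ => max v 0 ^ n) volume p q := fun p q =>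
    (by fun_prop : Continuous fun v : ℝ => max v 0 ^ n).intervalIntegrable _ _
  have h0 : ∀ p : ℝ, p ≤ 0 → ∫ v in p..0, max v 0 ^ n = 0 := by
    intro p hp
    rw [intervalIntegral.integral_congr (g := fun _ => 0)]
    · simp
    · intro v hv
      rw [Set.uIcc_of_le hp] at hv
      simp [max_eq_right hv.2, hn]
  have h1 : ∫ v in (d + b * (-1))..(d + b * 1), max v 0 ^ n ≤ max (d + b) 0 ^ (n + 1) / (n + 1) := by
    have h2 : ∫ v in (0 : ℝ)..(max (d + b) 0), max v 0 ^ n = max (d + b) 0 ^ (n + 1) / (n + 1) := by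
      rw [intervalIntegral.integral_congr (g := fun v => v ^ n), integral_pow]
      · simp
      · intro v hv
        rw [Set.uIcc_of_le (le_max_right _ _)] at hv
        simp [max_eq_left hv.1]
    have h3 := intervalIntegral.integral_add_adjacent_intervals
      (hi (min (d + b * (-1)) 0) 0) (hi 0 (max (d + b) 0))
    rw [h0 _ (min_le_right _ _), zero_add, h2] at h3
    rw [h3]
    apply intervalIntegral.integral_mono_interval (min_le_left _ _) (by linarith)
      (by rw [mul_one]; exact le_max_left _ _) _ (hi _ _)
    exact Filter.Eventually.of_forall fun v => by positivity
  rw [intervalIntegral.integral_comp_add_mul (fun v => max v 0 ^ n) hb.ne', smul_eq_mul]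
  calc (1 / 2) * (b⁻¹ * ∫ v in (d + b * (-1))..(d + b * 1), max v 0 ^ n)
      ≤ (1 / 2) * (b⁻¹ * (max (d + b) 0 ^ (n + 1) / (n + 1))) := by gcongr
    _ = _ := by field_simp

/-- The tail functions `G s x` of sums `∑_{i ∈ s} a i * U i` of independent uniform variables,
characterized by the empty sum and by adding one summand at a time. -/
structure IsUniformSumTail {ι : Type*} [DecidableEq ι] (a : ι → ℝ) (G : Finset ι → ℝ → ℝ) :
    Prop where
  empty_apply : ∀ x, G ∅ x = if x < 0 then 1 else 0
  insert_apply : ∀ s i, i ∉ s → ∀ x, G (insert i s) x = (1 / 2) * ∫ u in (-1 : ℝ)..1, G s (x - a i * u)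

namespace IsUniformSumTail

variable {ι : Type*} [DecidableEq ι] {a : ι → ℝ} {G : Finset ι → ℝ → ℝ}

theorem exists_density (hG : IsUniformSumTail a G) {s : Finset ι} (hs : s.Nonempty)
    (ha : ∀ i ∈ s, 0 < a i) :
    ∃ f, IsLogConcaveDensity f ((∑ i ∈ s, a i ^ 2) / 3) ∧ ∀ x, G s x = ∫ z in Set.Ioi x, f z := by
  induction hs using Finset.Nonempty.cons_induction with
  | singleton i =>
    have hi : 0 < a i := ha i (by simp)
    refine ⟨boxDensity (a i), by simpa using isLogConcaveDensity_boxDensity hi, fun x => ?_⟩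
    have h1 := hG.insert_apply ∅ i (by simp) x
    rw [insert_empty_eq] at h1
    rw [h1, ← integral_boxDensity_mul hi fun y => G ∅ (x - y), ← integral_indicator measurableSet_Ioi]
    congr 1; ext y
    rw [hG.empty_apply]
    by_cases h : x < y <;> simp [h]
  | cons i s hi hs ih =>
    obtain ⟨f, hf, hfG⟩ := ih fun j hj => ha j (by simp [hj])
    have hi0 : 0 < a i := ha i (by simp)
    have hk := isLogConcaveDensity_boxDensity hi0
    refine ⟨fun z => ∫ y, boxDensity (a i) y * f (z - y), ?_, fun x => ?_⟩
    · have := hf.convolution hk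
      rwa [← add_div, add_comm, ← Finset.sum_cons (f := fun i => a i ^ 2) hi] at this
    · rw [hf.integral_Ioi_convolution hk, Finset.cons_eq_insert, hG.insert_apply s i hi]
      simp only [← hfG]
      rw [integral_boxDensity_mul hi0 fun y => G s (x - y)]

theorem le_of_small (hG : IsUniformSumTail a G) {s : Finset ι} (hs : s.Nonempty)
    (ha : ∀ i ∈ s, 0 < a i) {ρ t : ℝ} (hρ : 0 < ρ) (hρs : ∑ i ∈ s, a i ^ 2 = ρ ^ 2) (ht : 0 < t)
    (ht' : t ≤ 1.05) : G s (t * ρ) ≤ cStar * upperTail t := by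
  obtain ⟨f, hf, hfG⟩ := hG.exists_density hs ha
  obtain ⟨R₀, hR₀, hR⟩ := hf.support
  -- The support radius is enlarged so that every node `s * ρ` with `s ≤ 1.05` lies strictly below
  -- `R`.
  set R := R₀ + 1.05 * ρ with hRdef
  have hR' : ∀ x, R < |x| → f x = 0 := fun x hx => hR x (by linarith)
  have hR0 : 0 ≤ R := by positivity
  have m1 : ∫ x in (0 : ℝ)..R, 2 * f x = 1 := by
    have := hf.integral_even_mul hR0 hR' (φ := fun _ => 1) (fun _ => rfl)
      (by simpa using hf.integrable)
    simp only [one_mul, hf.mass] at this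
    exact this.symm
  have m2 : ∫ x in (0 : ℝ)..R, x ^ 2 * (2 * f x) = ρ ^ 2 / 3 := by
    rw [← hf.integral_even_mul hR0 hR' (φ := fun x => x ^ 2) (fun x => by ring) hf.integrable_sq,
      hf.moment, hρs]
  have anti : AntitoneOn (fun x => 2 * f x) (Set.Ici 0) := fun x hx y hy hxy =>
    mul_le_mul_of_nonneg_left (hf.antitoneOn hx hy hxy) zero_le_two
  have key := tail_le_of_logConcave (g := fun x => 2 * f x) (ρ := ρ) (R := R) (t := t)
    (fun x _ => mul_nonneg zero_le_two (hf.nonneg x)) anti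
    (fun x y _ hxy => by nlinarith [hf.midpoint x y hxy]) hρ (by linarith) m1 m2 ht ht'
  rw [intervalIntegral.integral_const_mul] at key
  rw [hfG, IsLogConcaveDensity.integral_Ioi_eq_of_support hR' (by nlinarith), upperTail]
  linarith

theorem antitone (hG : IsUniformSumTail a G) {s : Finset ι} (hs : s.Nonempty)
    (ha : ∀ i ∈ s, 0 < a i) : Antitone (G s) := by
  obtain ⟨f, hf, hfG⟩ := hG.exists_density hs ha
  intro x y hxy
  rw [hfG, hfG]
  exact setIntegral_mono_set hf.integrable.integrableOn
    (Filter.Eventually.of_forall fun z => hf.nonneg z) (Set.Ioi_subset_Ioi hxy).eventuallyLE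

theorem intervalIntegrable (hG : IsUniformSumTail a G) {s : Finset ι} (hs : s.Nonempty)
    (ha : ∀ i ∈ s, 0 < a i) {b : ℝ} (hb : 0 ≤ b) (x : ℝ) :
    IntervalIntegrable (fun u => G s (x - b * u)) volume (-1) 1 := by
  apply Monotone.intervalIntegrable
  intro u v huv
  exact hG.antitone hs ha (by nlinarith)

theorem singleton_apply (hG : IsUniformSumTail a G) {i : ι} (hi : 0 < a i) {x : ℝ}
    (hx : -a i ≤ x) : G {i} x = max (a i - x) 0 / (2 * a i) := by
  have h1 := hG.insert_apply ∅ i (by simp) x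
  rw [insert_empty_eq] at h1
  rw [h1, ← integral_boxDensity_mul hi fun y => G ∅ (x - y)]
  have h2 : ∀ y, boxDensity (a i) y * G ∅ (x - y) =
      (Set.Ioc x (a i)).indicator (fun _ => (2 * a i)⁻¹) y := by
    intro y
    rw [hG.empty_apply, boxDensity]
    by_cases h : x < y
    · by_cases h' : y ≤ a i
      · have : y ∈ Set.Icc (-a i) (a i) := ⟨by linarith, h'⟩
        simp [h, h', this]
      · have : y ∉ Set.Icc (-a i) (a i) := fun hc => h' hc.2
        simp [h', this]
    · simp [h]
  simp only [h2]
  rw [integral_indicator measurableSet_Ioc, setIntegral_const, Real.volume_real_Ioc, smul_eq_mul,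
    div_eq_mul_inv]

theorem integral_le_of_le (hG : IsUniformSumTail a G) {s : Finset ι} (hs : s.Nonempty)
    (ha : ∀ i ∈ s, 0 < a i) {i : ι} (hi : i ∉ s) (hi0 : 0 < a i) {x : ℝ} {φ : ℝ → ℝ}
    (hφ : Continuous φ) (h : ∀ u ∈ Set.Icc (-1 : ℝ) 1, G s (x - a i * u) ≤ φ u) :
    G (insert i s) x ≤ (1 / 2) * ∫ u in (-1 : ℝ)..1, φ u := by
  rw [hG.insert_apply s i hi]
  apply mul_le_mul_of_nonneg_left _ (by norm_num)
  exact intervalIntegral.integral_mono_on (by norm_num) (hG.intervalIntegrable hs ha hi0.le x)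
    (hφ.intervalIntegrable _ _) h

/-- The points of the box `∏ [-a i, a i]` with coordinate sum above `x` lie in a corner simplex with
side `∑ a i - x`; the bound is its volume over that of the box. The induction integrates one
coordinate at a time. -/
theorem le_pow_div (hG : IsUniformSumTail a G) {s : Finset ι} (hs : s.Nonempty)
    (ha : ∀ i ∈ s, 0 < a i) (x : ℝ) :
    G s x ≤ max (∑ i ∈ s, a i - x) 0 ^ s.card / (s.card.factorial * ∏ i ∈ s, (2 * a i)) := by
  induction hs using Finset.Nonempty.cons_induction generalizing x with
  | singleton i =>
    have hi : 0 < a i := ha i (by simp)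
    simp only [Finset.sum_singleton, Finset.card_singleton, pow_one, Nat.factorial_one,
      Nat.cast_one, one_mul, Finset.prod_singleton]
    rcases le_total (-a i) x with h | h
    · exact (hG.singleton_apply hi h).le
    · have h1 := hG.insert_apply ∅ i (by simp) x
      have h2 : G {i} x ≤ 1 := by
        rw [insert_empty_eq] at h1
        rw [h1, ← integral_boxDensity_mul hi fun y => G ∅ (x - y)]
        have hk := isLogConcaveDensity_boxDensity hi
        rw [← hk.mass]
        apply integral_mono_of_nonneg _ hk.integrable
        · refine Filter.Eventually.of_forall fun y => ?_
          have : G ∅ (x - y) ≤ 1 := by rw [hG.empty_apply]; split_ifs <;> norm_num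
          exact mul_le_of_le_one_right (hk.nonneg y) this
        · refine Filter.Eventually.of_forall fun y => ?_
          have : 0 ≤ G ∅ (x - y) := by rw [hG.empty_apply]; split_ifs <;> norm_num
          exact mul_nonneg (hk.nonneg y) this
      refine h2.trans ?_
      rw [le_div_iff₀ (by positivity)]
      exact le_max_of_le_left (by linarith)
  | cons i s hi hs ih =>
    have ha' : ∀ j ∈ s, 0 < a j := fun j hj => ha j (by simp [hj])
    have hi0 : 0 < a i := ha i (by simp)
    set D : ℝ := s.card.factorial * ∏ j ∈ s, (2 * a j) with hD
    have hD0 : 0 < D := mul_pos (by positivity)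
      (Finset.prod_pos fun j hj => mul_pos two_pos (ha' j hj))
    have key := hG.integral_le_of_le hs ha' hi hi0 (x := x)
      (φ := fun u => max (∑ j ∈ s, a j - x + a i * u) 0 ^ s.card / D) (by fun_prop) fun u _ => by
        have := ih ha' (x - a i * u)
        rwa [← sub_add] at this
    rw [Finset.cons_eq_insert]
    refine key.trans ?_
    rw [intervalIntegral.integral_div, ← mul_div_assoc, Finset.sum_insert hi,
      Finset.prod_insert hi, Finset.card_insert_of_notMem hi, div_le_iff₀ hD0]
    refine (integral_posPart_pow_le hi0 hs.card_pos.ne').trans (le_of_eq ?_)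
    rw [Nat.factorial_succ, show ∑ j ∈ s, a j - x + a i = a i + ∑ j ∈ s, a j - x by ring]
    have hP : ∏ j ∈ s, (2 * a j) ≠ 0 :=
      (Finset.prod_pos fun j hj => mul_pos two_pos (ha' j hj)).ne'
    push_cast
    rw [hD]
    field_simp

end IsUniformSumTail

/-! ### Thresholds above `1.05`: comparable summands and the induction -/

theorem upperTail_nonneg {t : ℝ} (ht : 0 ≤ t) : 0 ≤ upperTail t := by
  have := two_mul_upperTail_eq ht
  have := gaussTail_nonneg (t * Real.sqrt 3)
  linarith

theorem le_chord_of_convexOn {ψ : ℝ → ℝ} (hψ : ConvexOn ℝ Set.univ ψ) {s₁ s₂ t b₁ b₂ : ℝ}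
    (h1 : s₁ ≤ t) (h2 : t ≤ s₂) (h12 : s₁ < s₂) (hb₁ : ψ s₁ ≤ b₁) (hb₂ : ψ s₂ ≤ b₂) :
    ψ t ≤ ((s₂ - t) * b₁ + (t - s₁) * b₂) / (s₂ - s₁) := by
  have hd : 0 < s₂ - s₁ := by linarith
  have := hψ.2 (Set.mem_univ s₁) (Set.mem_univ s₂)
    (div_nonneg (sub_nonneg.2 h2) hd.le) (div_nonneg (sub_nonneg.2 h1) hd.le)
    (by field_simp; ring)
  have e : ((s₂ - t) / (s₂ - s₁)) • s₁ + ((t - s₁) / (s₂ - s₁)) • s₂ = t := by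
    simp only [smul_eq_mul]; field_simp; ring
  rw [e, smul_eq_mul, smul_eq_mul] at this
  refine this.trans ?_
  rw [add_div, mul_div_right_comm, mul_div_right_comm]
  exact add_le_add (mul_le_mul_of_nonneg_left hb₁ (div_nonneg (sub_nonneg.2 h2) hd.le))
    (mul_le_mul_of_nonneg_left hb₂ (div_nonneg (sub_nonneg.2 h1) hd.le))

/-- Chords against tangents again, now at the nodes `1.05`, `1.3`, `1.55`. On `[1.55, 1.7321]`
monotonicity alone suffices, and beyond `1.7321`, which is just above `√3`, the bound `ψ` is
nonpositive. -/
theorem le_cStar_mul_of_convexOn {ψ : ℝ → ℝ} (hψ : ConvexOn ℝ Set.univ ψ) (anti : Antitone ψ)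
    (h1 : ψ 1.05 ≤ 0.077) (h2 : ψ 1.3 ≤ 0.0195) (h3 : ψ 1.55 ≤ 0.0015) (h4 : ψ 1.7321 ≤ 0)
    {t : ℝ} (ht : 1.05 ≤ t) : ψ t ≤ cStar * (1 - gaussScale * gaussInt t) := by
  have ht0 : 0 ≤ t := by linarith
  rcases le_total t 1.3 with h | h
  · refine (le_chord_of_convexOn hψ ht h (by norm_num) h1 h2).trans
      (chord_le_cStar_mul (m := 1.2) (by norm_num) ht0 ht h (by norm_num) (by norm_num)
        (by norm_num) ?_ ?_)
    all_goals
      have h1 := gaussInt_le 8 (t := 1.2) (by norm_num)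
      have h2 := sum_le_exp_of_even 8 (-(3 / 2 * 1.2 ^ 2))
      have h3 := exp_le_sum_of_odd 8 (x := -(3 / 2 * 1.2 ^ 2)) (by norm_num)
      norm_num [Finset.sum_range_succ, Nat.factorial] at h1 h2 h3
    · exact le_tangent_of_bound (e := 0.6798) (by norm_num; linarith) (by norm_num) (by norm_num)
    · exact le_tangent_of_bound (e := 0.7085) (by norm_num; linarith) (by norm_num) (by norm_num)
  rcases le_total t 1.55 with h' | h'
  · refine (le_chord_of_convexOn hψ h h' (by norm_num) h2 h3).trans
      (chord_le_cStar_mul (m := 1.4) (by norm_num) ht0 h h' (by norm_num) (by norm_num)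
        (by norm_num) ?_ ?_)
    all_goals
      have h1 := gaussInt_le 9 (t := 1.4) (by norm_num)
      have h2 := sum_le_exp_of_even 9 (-(3 / 2 * 1.4 ^ 2))
      have h3 := exp_le_sum_of_odd 9 (x := -(3 / 2 * 1.4 ^ 2)) (by norm_num)
      norm_num [Finset.sum_range_succ, Nat.factorial] at h1 h2 h3
    · exact le_tangent_of_bound (e := 0.7085) (by norm_num; linarith) (by norm_num) (by norm_num)
    · exact le_tangent_of_bound (e := 0.7215) (by norm_num; linarith) (by norm_num) (by norm_num)
  rcases le_total t 1.7321 with h'' | h''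
  · refine ((anti h').trans h3).trans ?_
    have k1 := gaussInt_le 9 (t := 1.7321) (by norm_num)
    norm_num [Finset.sum_range_succ, Nat.factorial] at k1
    have k2 : gaussInt t ≤ 0.7227 := (gaussInt_mono h'').trans (by linarith)
    have k3 : gaussScale * gaussInt t ≤ 1.38197659789 * 0.7227 :=
      (mul_le_mul_of_nonneg_left k2 gaussScale_pos.le).trans
        (mul_le_mul_of_nonneg_right gaussScale_lt.le (by norm_num))
    have k4 := mul_le_mul_of_nonneg_right le_cStar
      (show (0 : ℝ) ≤ 1 - gaussScale * gaussInt t by linarith)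
    linarith
  · refine ((anti h'').trans h4).trans ?_
    have := upperTail_nonneg ht0
    rw [upperTail] at this
    exact mul_nonneg cStar_pos.le (by linarith)

theorem posPart_pow_le_cStar_mul {w D : ℝ} (n : ℕ) (hn : n ≠ 0) (hD : 0 < D) (hw : w ≤ 1.7321)
    (h1 : max (w - 1.05) 0 ^ n ≤ 0.077 * D) (h2 : max (w - 1.3) 0 ^ n ≤ 0.0195 * D)
    (h3 : max (w - 1.55) 0 ^ n ≤ 0.0015 * D) {t : ℝ} (ht : 1.05 ≤ t) :
    max (w - t) 0 ^ n / D ≤ cStar * (1 - gaussScale * gaussInt t) := by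
  have hc : ConvexOn ℝ Set.univ fun t => max (w - t) 0 ^ n := by
    apply ConvexOn.pow (f := fun t => max (w - t) 0)
    · exact ((convexOn_const w convex_univ).sub (concaveOn_id convex_univ)).sup
        (convexOn_const 0 convex_univ)
    · intro x _; exact le_max_right _ _
  have hc' : ConvexOn ℝ Set.univ fun t => max (w - t) 0 ^ n / D := by
    have := hc.smul (inv_nonneg.2 hD.le)
    simpa only [smul_eq_mul, inv_mul_eq_div] using this
  apply le_cStar_mul_of_convexOn hc' _ _ _ _ _ ht
  · intro x y hxy
    dsimp only
    gcongr
  · exact (div_le_iff₀ hD).2 h1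
  · exact (div_le_iff₀ hD).2 h2
  · exact (div_le_iff₀ hD).2 h3
  · rw [max_eq_right (by linarith), zero_pow hn, zero_div]

/-- The case of two comparable summands. -/
theorem pair_bound {p q t : ℝ} (hp : 0 < p) (hq : 0 < q) (h : p ^ 2 + q ^ 2 = 1)
    (hp' : 1 / 4 ≤ p ^ 2) (hq' : 1 / 4 ≤ q ^ 2) (ht : 1.05 ≤ t) :
    max (p + q - t) 0 ^ 2 / (4 * (p * q)) ≤ cStar * (1 - gaussScale * gaussInt t) := by
  -- The product is at least `√3 / 4`, with equality when one of the squares is `1/4`, and the sum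
  -- is at most `√2`. These are estimated separately, giving `D = 4 * 0.433` and `w = 1.4143`.
  have hpq : 0.433 ≤ p * q := by
    apply le_of_sq_le_sq _ (by positivity)
    nlinarith [mul_nonneg (sub_nonneg.2 hp') (sub_nonneg.2 hq')]
  have hs : p + q ≤ 1.4143 := by
    apply le_of_sq_le_sq _ (by norm_num)
    nlinarith [sq_nonneg (p - q)]
  refine le_trans ?_ (posPart_pow_le_cStar_mul (w := 1.4143) (D := 1.732) 2 (by norm_num)
    (by norm_num) (by norm_num) (by norm_num) (by norm_num) (by norm_num) ht)
  have : max (p + q - t) 0 ≤ max (1.4143 - t) 0 := max_le_max (by linarith) le_rfl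
  have := le_max_right (p + q - t) 0
  gcongr
  linarith

/-- The case of three comparable summands. -/
theorem triple_bound {p q r t : ℝ} (hp : 0 < p) (hq : 0 < q) (hr : 0 < r)
    (h : p ^ 2 + q ^ 2 + r ^ 2 = 1) (hp' : 1 / 4 ≤ p ^ 2) (hq' : 1 / 4 ≤ q ^ 2)
    (hr' : 1 / 4 ≤ r ^ 2) (ht : 1.05 ≤ t) :
    max (p + q + r - t) 0 ^ 3 / (24 * (p * q * r)) ≤
      cStar * (1 - gaussScale * gaussInt t) := by
  have hpq : 0.1767 ≤ p * q * r := by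
    apply le_of_sq_le_sq _ (by positivity)
    -- The excesses of the three squares over `1/4` are nonnegative with sum `1/4`. The product of
    -- the squares is least when one excess takes everything, with value `1/32`.
    obtain ⟨A, hA⟩ : ∃ A, A = p ^ 2 - 1 / 4 := ⟨_, rfl⟩
    obtain ⟨B, hB⟩ : ∃ B, B = q ^ 2 - 1 / 4 := ⟨_, rfl⟩
    have hA0 : 0 ≤ A := by linarith
    have hB0 : 0 ≤ B := by linarith
    have hC0 : 0 ≤ 1 / 4 - A - B := by linarith
    have e : (p * q * r) ^ 2 = (1 / 4 + A) * (1 / 4 + B) * (1 / 4 + (1 / 4 - A - B)) := by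
      rw [mul_pow, mul_pow, hA, hB, show r ^ 2 = 1 - p ^ 2 - q ^ 2 by linarith]; ring
    rw [e]
    nlinarith [mul_nonneg hA0 hB0, mul_nonneg hA0 hC0, mul_nonneg hB0 hC0,
      mul_nonneg (mul_nonneg hA0 hB0) hC0]
  have hs : p + q + r ≤ 1.7321 := by
    apply le_of_sq_le_sq _ (by norm_num)
    nlinarith [sq_nonneg (p - q), sq_nonneg (p - r), sq_nonneg (q - r)]
  refine le_trans ?_ (posPart_pow_le_cStar_mul (w := 1.7321) (D := 4.2408) 3 (by norm_num)
    (by norm_num) (by norm_num) (by norm_num) (by norm_num) (by norm_num) ht)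
  have : max (p + q + r - t) 0 ≤ max (1.7321 - t) 0 := max_le_max (by linarith) le_rfl
  have := le_max_right (p + q + r - t) 0
  gcongr
  linarith

namespace IsUniformSumTail

variable {ι : Type*} [DecidableEq ι] {a : ι → ℝ} {G : Finset ι → ℝ → ℝ}

/-- Squares all exceeding a quarter of their sum leave room for at most three summands. For one
summand the tail vanishes because `t > 1`; two and three are `pair_bound` and `triple_bound` after
scaling by `ρ`. -/
theorem le_of_comparable (hG : IsUniformSumTail a G) {s : Finset ι} (hs : s.Nonempty)
    (ha : ∀ i ∈ s, 0 < a i) {ρ t : ℝ} (hρ : 0 < ρ) (hρs : ∑ i ∈ s, a i ^ 2 = ρ ^ 2)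
    (hc : ∀ i ∈ s, ρ ^ 2 / 4 < a i ^ 2) (ht : 1.05 ≤ t) :
    G s (t * ρ) ≤ cStar * upperTail t := by
  have hcard : s.card < 4 := by
    by_contra h
    have h1 := Finset.sum_lt_sum_of_nonempty hs hc
    rw [Finset.sum_const, nsmul_eq_mul, hρs] at h1
    have h2 : (4 : ℝ) ≤ s.card := by exact_mod_cast not_lt.1 h
    nlinarith [sq_nonneg ρ]
  have hpos := hs.card_pos
  have hb := hG.le_pow_div hs ha (t * ρ)
  have hn : ∀ i ∈ s, 1 / 4 ≤ (a i / ρ) ^ 2 := by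
    intro i hi
    rw [div_pow, le_div_iff₀ (by positivity)]
    linarith [hc i hi]
  have ht0 : 0 ≤ t := by linarith
  have hmax : ∀ w : ℝ, max (w - t * ρ) 0 = ρ * max (w / ρ - t) 0 := by
    intro w
    rw [mul_max_of_nonneg _ _ hρ.le, mul_zero]
    congr 1; field_simp
  rw [upperTail, mul_div_assoc']
  interval_cases hcs : s.card
  · obtain ⟨i, rfl⟩ := Finset.card_eq_one.1 hcs
    have hi := ha i (by simp)
    have e : a i = ρ := by
      rw [Finset.sum_singleton] at hρs
      exact (pow_left_inj₀ hi.le hρ.le two_ne_zero).1 hρs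
    rw [Finset.sum_singleton, e, max_eq_right (by nlinarith)] at hb
    refine hb.trans ?_
    have := mul_nonneg cStar_pos.le (upperTail_nonneg ht0)
    rw [upperTail] at this
    rw [zero_pow one_ne_zero, zero_div]
    linarith
  · obtain ⟨i, j, hij, rfl⟩ := Finset.card_eq_two.1 hcs
    have hi := ha i (by simp)
    have hj := ha j (by simp)
    rw [Finset.sum_pair hij] at hρs hb
    rw [Finset.prod_pair hij, hmax] at hb
    have key := pair_bound (p := a i / ρ) (q := a j / ρ) (by positivity) (by positivity)
      (by rw [div_pow, div_pow, ← add_div, hρs]; field_simp) (hn i (by simp)) (hn j (by simp)) ht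
    rw [← add_div] at key
    have e : (ρ * max ((a i + a j) / ρ - t) 0) ^ 2 /
        ((Nat.factorial 2 : ℕ) * (2 * a i * (2 * a j))) =
        max ((a i + a j) / ρ - t) 0 ^ 2 / (4 * (a i / ρ * (a j / ρ))) / 2 := by
      simp only [Nat.factorial]; field_simp; norm_num; ring
    rw [e] at hb
    linarith
  · obtain ⟨i, j, k, hij, hik, hjk, rfl⟩ := Finset.card_eq_three.1 hcs
    have hi := ha i (by simp)
    have hj := ha j (by simp)
    have hk := ha k (by simp)
    have hi' : i ∉ ({j, k} : Finset ι) := by simp [hij, hik]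
    rw [Finset.sum_insert hi', Finset.sum_pair hjk, ← add_assoc] at hρs hb
    rw [Finset.prod_insert hi', Finset.prod_pair hjk, hmax] at hb
    have key := triple_bound (p := a i / ρ) (q := a j / ρ) (r := a k / ρ) (by positivity)
      (by positivity) (by positivity)
      (by rw [div_pow, div_pow, div_pow, ← add_div, ← add_div, hρs]; field_simp)
      (hn i (by simp)) (hn j (by simp)) (hn k (by simp)) ht
    rw [← add_div, ← add_div] at key
    have e : (ρ * max ((a i + a j + a k) / ρ - t) 0) ^ 3 /
        ((Nat.factorial 3 : ℕ) * (2 * a i * (2 * a j * (2 * a k)))) =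
        max ((a i + a j + a k) / ρ - t) 0 ^ 3 / (24 * (a i / ρ * (a j / ρ) * (a k / ρ))) / 2 := by
      simp only [Nat.factorial]; field_simp; norm_num; ring
    rw [e] at hb
    linarith

/-- The one-sided tail comparison. -/
theorem le_cStar_mul_upperTail (hG : IsUniformSumTail a G) (s : Finset ι) (hs : s.Nonempty)
    (ha : ∀ i ∈ s, 0 < a i) {ρ t : ℝ} (hρ : 0 < ρ) (hρs : ∑ i ∈ s, a i ^ 2 = ρ ^ 2)
    (ht : 0 < t) : G s (t * ρ) ≤ cStar * upperTail t := by
  induction s using Finset.strongInduction generalizing ρ t with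
  | H s ih =>
  rcases le_total t 1.05 with ht' | ht'
  · exact hG.le_of_small hs ha hρ hρs ht ht'
  by_cases hc : ∀ i ∈ s, ρ ^ 2 / 4 < a i ^ 2
  · exact hG.le_of_comparable hs ha hρ hρs hc ht'
  push Not at hc
  obtain ⟨i, hi, hia⟩ := hc
  have hi0 := ha i hi
  have hsum : ∑ j ∈ s.erase i, a j ^ 2 = ρ ^ 2 - a i ^ 2 := by
    rw [← hρs, ← Finset.add_sum_erase s _ hi]; ring
  have hne : (s.erase i).Nonempty := by
    by_contra h
    rw [Finset.not_nonempty_iff_eq_empty] at h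
    rw [h, Finset.sum_empty] at hsum
    nlinarith [pow_pos hρ 2]
  have ha' : ∀ j ∈ s.erase i, 0 < a j := fun j hj => ha j (Finset.mem_of_mem_erase hj)
  set p := a i / ρ with hp
  have hp0 : 0 < p := by positivity
  have hpa : a i = p * ρ := by rw [hp]; field_simp
  have hp2 : p ≤ 1 / 2 := by
    apply le_of_sq_le_sq _ (by norm_num)
    rw [hp, div_pow, div_le_iff₀ (by positivity)]
    linarith
  set σ := Real.sqrt (1 - p ^ 2) with hσ
  have hσ2 : σ ^ 2 = 1 - p ^ 2 := Real.sq_sqrt (by nlinarith)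
  have hσ0 : 0 < σ := Real.sqrt_pos.2 (by nlinarith)
  -- Given `U i = u`, the other summands have norm `ρ * σ` and must exceed `(t - p * u) / σ` times
  -- that norm. This threshold may drop below `1.05`, so the induction hypothesis is kept for all
  -- positive thresholds.
  have key := hG.integral_le_of_le hne ha' (Finset.notMem_erase i s) hi0 (x := t * ρ)
    (φ := fun u => cStar * upperTail ((t - p * u) / σ))
    (by
      have := continuous_gaussInt
      unfold upperTail
      fun_prop) (fun u hu => by
      have h1 : 0 < (t - p * u) / σ := by
        apply div_pos _ hσ0
        nlinarith [hu.2]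
      have h2 := ih (s.erase i) (Finset.erase_ssubset hi) hne ha' (ρ := ρ * σ) (by positivity)
        (by rw [hsum, mul_pow, hσ2, hpa]; ring) h1
      convert h2 using 2
      rw [hpa]; field_simp)
  rw [Finset.insert_erase hi, intervalIntegral.integral_const_mul] at key
  have hsm := upperTail_smoothing hp0.le hp2 ht'
  rw [← hσ] at hsm
  have := mul_le_mul_of_nonneg_left hsm cStar_pos.le
  linarith

end IsUniformSumTail

/-! ### From the recursion to random variables -/

namespace IsUniformSumTail

variable {ι : Type*} [DecidableEq ι] {a : ι → ℝ} {G : Finset ι → ℝ → ℝ}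

theorem abs (hG : IsUniformSumTail a G) : IsUniformSumTail (fun i => |a i|) G where
  empty_apply := hG.empty_apply
  insert_apply s i hi x := by
    rw [hG.insert_apply s i hi]
    rcases abs_choice (a i) with h | h
    · rw [h]
    · have := intervalIntegral.integral_comp_neg (a := -1) (b := 1) (fun u => G s (x - a i * u))
      rw [neg_neg] at this
      rw [h, ← this]
      simp only [mul_neg, neg_mul]

end IsUniformSumTail

section Uniform

variable {Ω : Type*} [MeasurableSpace Ω] {μ : Measure Ω}

theorem aemeasurable_of_isUniform_Icc {X : Ω → ℝ}
    (hX : pdf.IsUniform X (Set.Icc (-1) 1) μ volume) : AEMeasurable X μ :=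
  hX.aemeasurable (by simp [Real.volume_Icc]) (by simp)

theorem integral_map_of_isUniform_Icc {X : Ω → ℝ}
    (hX : pdf.IsUniform X (Set.Icc (-1) 1) μ volume) (φ : ℝ → ℝ) :
    ∫ u, φ u ∂(μ.map X) = (1 / 2) * ∫ u in (-1 : ℝ)..1, φ u := by
  rw [show μ.map X = ProbabilityTheory.cond volume (Set.Icc (-1) 1) from hX,
    ProbabilityTheory.cond, integral_smul_measure, integral_Icc_eq_integral_Ioc,
    ← intervalIntegral.integral_of_le (by norm_num), Real.volume_Icc, smul_eq_mul]
  norm_num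

theorem measureReal_lt_abs_of_isUniform_Icc [IsProbabilityMeasure μ] {X : Ω → ℝ}
    (hX : pdf.IsUniform X (Set.Icc (-1) 1) μ volume) {t : ℝ} (ht : 0 ≤ t) (ht1 : t ≤ 1) :
    μ.real {ω | t < |X ω|} = 1 - t := by
  have hm := aemeasurable_of_isUniform_Icc hX
  have h1 : μ.real (X ⁻¹' Set.Icc (-t) t) = t := by
    rw [measureReal_def, hX.measure_preimage (by simp [Real.volume_Icc]) (by simp)
      measurableSet_Icc, Set.Icc_inter_Icc, max_eq_right (by linarith), min_eq_right ht1,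
      Real.volume_Icc, Real.volume_Icc, ENNReal.toReal_div, ENNReal.toReal_ofReal (by linarith),
      ENNReal.toReal_ofReal (by norm_num)]
    ring
  have h2 : {ω | t < |X ω|} = (X ⁻¹' Set.Icc (-t) t)ᶜ := by
    ext ω
    simp [← abs_le]
  rw [h2, probReal_compl_eq_one_sub₀ (hm.nullMeasurable measurableSet_Icc), h1]

theorem isUniformSumTail_of_iIndepFun [IsProbabilityMeasure μ] {ι : Type*} [DecidableEq ι]
    {U : ι → Ω → ℝ} (hU : iIndepFun U μ)
    (hu : ∀ i, pdf.IsUniform (U i) (Set.Icc (-1) 1) μ volume) (a : ι → ℝ) :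
    IsUniformSumTail a fun s x => μ.real {ω | x < ∑ i ∈ s, a i * U i ω} where
  empty_apply x := by
    simp only [Finset.sum_empty]
    split_ifs with h <;> simp [h]
  insert_apply s i hi x := by
    have hm := fun i => aemeasurable_of_isUniform_Icc (hu i)
    set Y : Ω → ℝ := fun ω => ∑ j ∈ s, a j * U j ω with hY
    have hYm : AEMeasurable Y μ := by
      apply Finset.aemeasurable_fun_sum
      exact fun j _ => (hm j).const_mul _
    have hind : IndepFun (U i) Y μ := by
      -- The coefficient at `i` is set to `1`, so that `U i` itself is independent of the weighted
      -- sum of the others.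
      have hf := hU.comp (fun j x => (if j = i then 1 else a j) * x) fun j => by fun_prop
      have h := hf.indepFun_finsetSum_of_notMem₀ (fun j => by
        exact (hm j).const_mul (if j = i then 1 else a j)) hi
      convert h.symm using 1
      · ext ω; simp
      · ext ω
        rw [hY, Finset.sum_apply]
        refine Finset.sum_congr rfl fun j hj => ?_
        have : j ≠ i := fun hc => hi (hc ▸ hj)
        simp [this]
    have hmap := (indepFun_iff_map_prod_eq_prod_map_map (hm i) hYm).1 hind
    have hS : MeasurableSet {p : ℝ × ℝ | x < a i * p.1 + p.2} :=
      measurableSet_lt measurable_const (by fun_prop)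
    have : IsProbabilityMeasure (μ.map (U i)) := Measure.isProbabilityMeasure_map (hm i)
    have : IsProbabilityMeasure (μ.map Y) := Measure.isProbabilityMeasure_map hYm
    rw [← integral_map_of_isUniform_Icc (hu i) fun u => μ.real {ω | x - a i * u < Y ω}]
    have e1 : {ω | x < ∑ j ∈ insert i s, a j * U j ω} =
        (fun ω => (U i ω, Y ω)) ⁻¹' {p : ℝ × ℝ | x < a i * p.1 + p.2} := by
      ext ω
      simp [Finset.sum_insert hi, hY]
    rw [e1, measureReal_def, ← Measure.map_apply_of_aemeasurable ((hm i).prodMk hYm) hS, hmap,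
      Measure.prod_apply hS, ← integral_toReal]
    · congr 1; ext u
      rw [Measure.map_apply_of_aemeasurable hYm (measurable_prodMk_left hS), measureReal_def]
      congr 2; ext ω
      simp [sub_lt_iff_lt_add']
    · exact (measurable_measure_prodMk_left hS).aemeasurable
    · exact Filter.Eventually.of_forall fun _ => measure_lt_top _ _

/-- The recursive comparison needs positive coefficients: signs are removed by the symmetry of the
uniform law, and indices with `a i = 0` are discarded. -/
theorem measureReal_lt_sum_le [IsProbabilityMeasure μ] {ι : Type*} [Fintype ι]
    {U : ι → Ω → ℝ} (hU : iIndepFun U μ)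
    (hu : ∀ i, pdf.IsUniform (U i) (Set.Icc (-1) 1) μ volume) {a : ι → ℝ}
    (ha : ∑ i, a i ^ 2 = 1) {t : ℝ} (ht : 0 < t) :
    μ.real {ω | t < ∑ i, a i * U i ω} ≤ cStar * upperTail t := by
  classical
  have hG := (isUniformSumTail_of_iIndepFun hU hu a).abs
  set s := Finset.univ.filter fun i => a i ≠ 0 with hs
  have hsum : ∑ i ∈ s, |a i| ^ 2 = 1 ^ 2 := by
    rw [one_pow, ← ha, hs, Finset.sum_filter]
    refine Finset.sum_congr rfl fun i _ => ?_
    by_cases h : a i = 0 <;> simp [h]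
  have hne : s.Nonempty := by
    by_contra h
    rw [Finset.not_nonempty_iff_eq_empty] at h
    simp [h] at hsum
  have key := hG.le_cStar_mul_upperTail s hne
    (fun i hi => abs_pos.2 (Finset.mem_filter.1 hi).2) one_pos hsum ht
  have he : ∀ ω, ∑ i ∈ s, a i * U i ω = ∑ i, a i * U i ω := fun ω => by
    rw [hs, Finset.sum_filter]
    refine Finset.sum_congr rfl fun i _ => ?_
    by_cases h : a i = 0 <;> simp [h]
  simpa only [he, mul_one] using key

theorem measureReal_lt_abs_sum_le [IsProbabilityMeasure μ] {ι : Type*} [Fintype ι]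
    {U : ι → Ω → ℝ} (hU : iIndepFun U μ)
    (hu : ∀ i, pdf.IsUniform (U i) (Set.Icc (-1) 1) μ volume) {a : ι → ℝ}
    (ha : ∑ i, a i ^ 2 = 1) {t : ℝ} (ht : 0 < t) :
    μ.real {ω | t < |∑ i, a i * U i ω|} ≤ cStar * gaussTail (t * Real.sqrt 3) := by
  have h1 := measureReal_lt_sum_le hU hu ha ht
  have h2 := measureReal_lt_sum_le hU hu (a := fun i => -a i) (by simpa using ha) ht
  have h3 : {ω | t < |∑ i, a i * U i ω|} ⊆
      {ω | t < ∑ i, a i * U i ω} ∪ {ω | t < ∑ i, -a i * U i ω} := by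
    intro ω hω
    simpa [lt_abs] using hω
  have h4 := (measureReal_mono h3 (measure_ne_top μ _)).trans (measureReal_union_le _ _)
  rw [← two_mul_upperTail_eq ht.le]
  linarith

theorem measureReal_lt_inv_sqrt_mul_abs {G : Ω → ℝ} (hG : HasLaw G (gaussianReal 0 1) μ) (t : ℝ) :
    μ.real {ω | t < 1 / Real.sqrt 3 * |G ω|} = gaussTail (t * Real.sqrt 3) := by
  have h1 : {ω | t < 1 / Real.sqrt 3 * |G ω|} = {ω | t * Real.sqrt 3 < |G ω|} := by
    ext ω
    have : 0 < Real.sqrt 3 := by positivity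
    rw [Set.mem_ofPred_eq, Set.mem_ofPred_eq, one_div_mul_eq_div, lt_div_iff₀ this]
  rw [h1, gaussTail, measureReal_def, measureReal_def,
    hG.measure_eq (p := fun x => t * Real.sqrt 3 < |x|)
      (measurableSet_lt measurable_const (by fun_prop))]

end Uniform

theorem theorem1 :
    -- the supremum defining `cStar` is finite, it is a maximum, and its value is `1.345118..`
    IsGreatest (tailRatio '' Set.Ioo (0 : ℝ) 1) cStar ∧
    1.345118 ≤ cStar ∧ cStar < 1.345119 ∧
    ∃ t₀ : ℝ,
      -- it is attained at `t₀ = 0.642908..` and nowhere else in `(0, 1)`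
      0.642908 ≤ t₀ ∧ t₀ < 0.642909 ∧
      (∀ t ∈ Set.Ioo (0 : ℝ) 1, tailRatio t = cStar ↔ t = t₀) ∧
      ∀ {Ω : Type*} [MeasurableSpace Ω] (μ : Measure Ω) [IsProbabilityMeasure μ]
        {Ω' : Type*} [MeasurableSpace Ω'] (ν : Measure Ω') [IsProbabilityMeasure ν]
        (U : ℕ → Ω → ℝ) (G : Ω' → ℝ),
        iIndepFun U μ →
        (∀ j, pdf.IsUniform (U j) (Set.Icc (-1) 1) μ volume) →
        HasLaw G (gaussianReal 0 1) ν →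
        -- the tail comparison
        (∀ (n : ℕ) (a : Fin n → ℝ), 1 ≤ n → ∑ j, a j ^ 2 = 1 → ∀ t : ℝ, 0 < t →
          μ.real {ω | t < |∑ j, a j * U j ω|} ≤
            cStar * ν.real {ω | t < 1 / Real.sqrt 3 * |G ω|}) ∧
        -- equality for `n = 1`, `a₁ = 1`, `t = t₀`
        μ.real {ω | t₀ < |∑ j : Fin 1, (1 : ℝ) * U j ω|} =
          cStar * ν.real {ω | t₀ < 1 / Real.sqrt 3 * |G ω|} ∧
        -- hence no smaller constant is possible
        (∀ C : ℝ,
          (∀ (n : ℕ) (a : Fin n → ℝ), 1 ≤ n → ∑ j, a j ^ 2 = 1 → ∀ t : ℝ, 0 < t →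
            μ.real {ω | t < |∑ j, a j * U j ω|} ≤
              C * ν.real {ω | t < 1 / Real.sqrt 3 * |G ω|}) →
          cStar ≤ C) := by
  obtain ⟨t₀, h0, h1, h2, h3⟩ := exists_cStar_maximizer
  have hmem : t₀ ∈ Set.Ioo (0 : ℝ) 1 := ⟨by linarith, by linarith⟩
  refine ⟨⟨⟨t₀, hmem, h2⟩, ?_⟩, le_cStar, cStar_lt, t₀, h0, h1, fun t ht => ⟨fun h => ?_, ?_⟩, ?_⟩
  · rintro _ ⟨t, ht, rfl⟩
    exact tailRatio_le_cStar ht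
  · by_contra hne
    exact (h3 t ht hne).ne h
  · rintro rfl
    exact h2
  intro Ω _ μ _ Ω' _ ν _ U G hU hu hG
  have hpos : 0 < gaussTail (t₀ * Real.sqrt 3) := by
    rw [gaussTail_mul_sqrt_three hmem.1.le]
    exact one_sub_gaussInt_pos hmem.2.le
  have heq : μ.real {ω | t₀ < |∑ j : Fin 1, (1 : ℝ) * U j ω|} =
      cStar * ν.real {ω | t₀ < 1 / Real.sqrt 3 * |G ω|} := by
    simp only [Fin.sum_univ_one, one_mul]
    rw [measureReal_lt_abs_of_isUniform_Icc (hu _) hmem.1.le hmem.2.le,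
      measureReal_lt_inv_sqrt_mul_abs hG, ← h2, tailRatio, div_mul_cancel₀ _ hpos.ne']
  refine ⟨fun n a _ ha t ht => ?_, heq, fun C hC => ?_⟩
  · rw [measureReal_lt_inv_sqrt_mul_abs hG]
    exact measureReal_lt_abs_sum_le (hU.precomp Fin.val_injective) (fun j => hu j) ha ht
  -- Testing `C` on one summand at `t₀` and dividing by the positive Gaussian tail there gives the
  -- lower bound.
  · have h := hC 1 (fun _ => 1) le_rfl (by simp) t₀ hmem.1
    rw [heq, measureReal_lt_inv_sqrt_mul_abs hG] at h
    exact le_of_mul_le_mul_right h hpos
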